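/- Let $p_{10},p_{-10},p_{01},p_{0-1}>0$ with $p_{10}+p_{-10}+p_{01}+p_{0-1}=1$, and consider the Markov chain $(X(k),Y(k))_{k\ge 0}$ on $\mathbb{Z}_+^2$ which from a point $(x,y)$ with $x,y>0$ jumps to $(x+1,y)$, $(x-1,y)$, $(x,y+1)$, $(x,y-1)$ with probabilities $p_{10}$, $p_{-10}$, $p_{01}$, $p_{0-1}$ respectively, all points of the two axes being absorbing. Assume that both drifts vanish: $p_{10}-p_{-10}=0$ and $p_{01}-p_{0-1}=0$. Let $G_{i,j}^{n_0,m_0}=\mathbb{E}_{(n_0,m_0)}\big[\sum_{k\ge 0}\mathbf{1}_{\{(X(k),Y(k))=(i,j)\}}\big]$ be the Green functions. (a) For all integers $n_0,m_0\ge 1$, the numbers $G_{i,j}^{n_0,m_0}$ with $i,j\ge1$ are finite, and as $i,j\to+\infty$ with $j/i\to\tan\gamma\in[0,+\infty]$ (any fixed $\gamma \in[0,\pi/2]$), $$G_{i,j}^{n_0,m_0}\sim \frac{4\sqrt{p_{01}p_{10}}}{\pi}\,n_0m_0\,\frac{ij}{(p_{01}i^2+p_{10}j^2)^2}.$$ (b)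 Let $E=\mathbb{Z}_+^2\setminus\{(0,0)\}$ with the discrete topology, and let the Martin kernel with reference state $(1,1)$ be, for $z,w\in E$, $k_z(w)=G_{w}^{z}/G_{w}^{(1,1)}$ if both coordinates of $w$ are positive, and $k_z(w)=\mathbb{P}_z(\text{to hit } w)/\mathbb{P}_{(1,1)}(\text{to hit } w)$ if $w$ lies on an axis. The Martin compactification is the smallest compactification of $E$ to which all functions $w\mapsto k_z(w)$, $z\in E$, extend continuously (realised as the closure of $\{(w,(k_z(w))_{z\in E}):w\in E\}$ in $(E\cup\{\infty\})\times[0,\infty]^E$, where $E\cup\{\infty\}$ is the one-point compactification), and the Martin boundary is the complement of $E$ in it. Then the Martin boundary consists of exactly one point $\xi$, and $k_{(n_0,m_0)}(\xi)=n_0m_0$ for all $(n_0,m_0)\in E$; that is, the function $n_0m_0$ is the unique point of the Martin boundary. -/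

import Mathlib

open MeasureTheory ProbabilityTheory Filter Topology Asymptotics
open scoped ENNReal NNReal

noncomputable section

namespace QuadrantWalk

/-- The jump probabilities of a nearest-neighbour walk in the interior of the quadrant:
`p10`, `pm10`, `p01`, `p0m1` are the probabilities of the jumps `(1, 0)`, `(-1, 0)`, `(0, 1)`,
`(0, -1)`. They are non-zero and sum to `1`. -/
structure JumpProb where
  p10 : ℝ≥0
  pm10 : ℝ≥0
  p01 : ℝ≥0
  p0m1 : ℝ≥0
  p10_ne : p10 ≠ 0
  pm10_ne : pm10 ≠ 0
  p01_ne : p01 ≠ 0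
  p0m1_ne : p0m1 ≠ 0
  sum_eq_one : p10 + pm10 + p01 + p0m1 = 1

namespace JumpProb

variable (p : JumpProb)

/-- The horizontal drift. -/
def driftX : ℝ := (p.p10 : ℝ) - (p.pm10 : ℝ)

/-- The vertical drift. -/
def driftY : ℝ := (p.p01 : ℝ) - (p.p0m1 : ℝ)

/-- The law of the position after one step from `z`: points of the axes are absorbing, and from an
interior point the walk makes one of the four jumps. -/
def stepLaw (z : ℕ × ℕ) : Measure (ℕ × ℕ) :=
  if z.1 = 0 ∨ z.2 = 0 then Measure.dirac z
  else (p.p10 : ℝ≥0∞) • Measure.dirac (z.1 + 1, z.2)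
    + (p.pm10 : ℝ≥0∞) • Measure.dirac (z.1 - 1, z.2)
    + (p.p01 : ℝ≥0∞) • Measure.dirac (z.1, z.2 + 1)
    + (p.p0m1 : ℝ≥0∞) • Measure.dirac (z.1, z.2 - 1)

theorem isProbabilityMeasure_stepLaw (z : ℕ × ℕ) : IsProbabilityMeasure (p.stepLaw z) := by
  unfold stepLaw
  split_ifs with h
  · infer_instance
  · constructor
    simp only [Measure.coe_add, Measure.coe_smul, Pi.add_apply, Pi.smul_apply, measure_univ,
      smul_eq_mul, mul_one]
    exact_mod_cast p.sum_eq_one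

/-- The transition kernel of the walk on `ℕ × ℕ`. -/
def stepKernel : Kernel (ℕ × ℕ) (ℕ × ℕ) := Kernel.ofFunOfCountable p.stepLaw

instance : IsMarkovKernel p.stepKernel := ⟨p.isProbabilityMeasure_stepLaw⟩

/-- The law of the next position given the past up to time `n`: it depends on the position at
time `n` only, through the transition kernel. -/
def historyKernel (n : ℕ) : Kernel (Π _ : Finset.Iic n, ℕ × ℕ) (ℕ × ℕ) :=
  p.stepKernel.comap (fun past => past ⟨n, Finset.mem_Iic.2 le_rfl⟩) (measurable_pi_apply _)

instance (n : ℕ) : IsMarkovKernel (p.historyKernel n) := by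
  unfold historyKernel
  infer_instance

/-- The law of the whole trajectory `(X(k), Y(k))`, `k ≥ 0`, of the walk started at `z`. -/
def pathLaw (z : ℕ × ℕ) : Measure (ℕ → ℕ × ℕ) :=
  Kernel.trajMeasure (X := fun _ => ℕ × ℕ) (Measure.dirac z) p.historyKernel

open Classical in
/-- The Green function: the mean number of visits to `w` starting from `z`. -/
def green (z w : ℕ × ℕ) : ℝ≥0∞ :=
  ∫⁻ ω, ∑' k : ℕ, (if ω k = w then (1 : ℝ≥0∞) else 0) ∂(p.pathLaw z)

/-- The probability of ever hitting `w` starting from `z`. -/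
def hitProb (z w : ℕ × ℕ) : ℝ≥0∞ := p.pathLaw z {ω | ∃ k : ℕ, ω k = w}

end JumpProb

/-- The state space of the walk, the quadrant without the origin (which cannot be reached from any
other point). -/
abbrev State : Type := {z : ℕ × ℕ // z ≠ (0, 0)}

namespace JumpProb

variable (p : JumpProb)

open Classical in
/-- The Martin kernel `k_z(w)` with reference state `(1, 1)`: a quotient of Green functions if `w`
is an interior point, a quotient of hitting probabilities if `w` lies on an axis. -/
def martinKernel (z w : State) : ℝ≥0∞ :=
  if 0 < w.1.1 ∧ 0 < w.1.2 then p.green z.1 w.1 / p.green (1, 1) w.1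
  else p.hitProb z.1 w.1 / p.hitProb (1, 1) w.1

/-- The embedding of the (discrete) state space which defines the Martin compactification: the
first component makes the image discrete, the second one records all the functions `k_z`. -/
def martinEmbedding (w : State) : OnePoint State × (State → ℝ≥0∞) :=
  ((w : OnePoint State), fun z => p.martinKernel z w)

/-- The Martin compactification, i.e. the smallest compactification of the discrete state space to
which every function `w ↦ k_z(w)` extends continuously. -/
def martinCompactification : Set (OnePoint State × (State → ℝ≥0∞)) :=
  closure (Set.range p.martinEmbedding)

/-- The Martin boundary. A point `ξ` of it has first component `∞`, and its second component is
the function `z ↦ k_z(ξ)`, where `k_z` is extended continuously. -/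
def martinBoundary : Set (OnePoint State × (State → ℝ≥0∞)) :=
  p.martinCompactification \ Set.range p.martinEmbedding

end JumpProb

end QuadrantWalk

end

/-!
The proof rests on an explicit formula for the Green function. In the driftless case write `a` for
the probability of each horizontal jump and `b` for that of each vertical one, so `2a + 2b = 1`, and
put `c ^ 2 = b / a`. Diagonalising the vertical direction by the functions `sin (m θ)` leaves, for
each frequency `θ`, a three-term recurrence in the horizontal direction with characteristic roots
`λ(θ)` and `λ(θ)⁻¹`, where `λ + λ⁻¹ = 2 + 2 c² (1 - cos θ)`. Hence
`G = 2 / (π a) ∫₀^π sin (m θ) sin (j θ) H(λ(θ)) dθ` (`sineGreen`), where `H = halfLineGreen` solves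
the recurrence with a unit source; for `i ≥ n` it is the sum of `λ ^ (i - n + 1 + 2 k)` over
`k < n`. This function is bounded and solves the Poisson equation of the walk killed on the axes,
and bounded solutions are unique: the killed operator iterated on a bounded function tends to `0`,
by the maximum principle with the harmonic barrier `ε (x + y)` (`tendsto_killedStep_iterate`). The
forward equation for the law of the walk then identifies it with the Green function
(`JumpProb.green_eq_of_killedStep`).

For targets with `j ≤ i`, substitute `θ = u / i`. The bound `|sin (j u / i)| ≤ (j / i) u` takes the
factor `j` out of the error, and what remains is an integral that depends on `i` only and tends to
`0` by dominated convergence, since `λ(u / i) ^ i → exp (-c u)`. The limiting integral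
`∫ u sin (s u) exp (-c u) du = 2 c s / (c² + s²)²` is the leading term. Targets with `i ≤ j` are
handled by exchanging the coordinates. The result (`JumpProb.tendsto_green_div_leadingTerm`) holds
uniformly as the target goes to infinity in the interior, even along a fixed row or column.

This uniformity gives the Martin boundary. A point of an axis is entered only from its interior
neighbour and is then never left, so the hitting probabilities are, up to a factor that cancels,
Green functions at that neighbour. Hence every Martin kernel `k_z(w)` tends to `n₀ m₀`, where
`z = (n₀, m₀)`, as `w` leaves all finite sets, and the closure of the embedded state space has
exactly one further point.
-/

/-! ### The law of the walk, absorption and hitting probabilities -/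

namespace QuadrantWalk

namespace JumpProb

variable (p : JumpProb)

instance (z : ℕ × ℕ) : IsProbabilityMeasure (p.pathLaw z) := by
  unfold pathLaw; infer_instance

/-- The Markov property, for two consecutive positions. -/
theorem lintegral_pathLaw_consecutive (z : ℕ × ℕ) (k : ℕ) (f : ℕ × ℕ → ℕ × ℕ → ℝ≥0∞) :
    ∫⁻ ω, f (ω k) (ω (k + 1)) ∂p.pathLaw z
      = ∫⁻ ω, ∫⁻ y, f (ω k) y ∂p.stepLaw (ω k) ∂p.pathLaw z := by
  have hf : Measurable (Function.uncurry f) := measurable_of_countable _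
  have key := Kernel.map_frestrictLe_trajMeasure_compProd_eq_map_trajMeasure
    (X := fun _ => ℕ × ℕ) (μ₀ := Measure.dirac z) (κ := p.historyKernel) (a := k)
  let g : (Π _ : Finset.Iic k, ℕ × ℕ) × (ℕ × ℕ) → ℝ≥0∞ :=
    fun x => Function.uncurry f (x.1 ⟨k, Finset.mem_Iic.2 le_rfl⟩, x.2)
  have hg : Measurable g := hf.comp
    (((measurable_pi_apply _).comp measurable_fst).prodMk measurable_snd)
  have h1 := lintegral_map (μ := p.pathLaw z) hg
    (g := fun x => (Preorder.frestrictLe (π := fun _ => ℕ × ℕ) k x, x (k + 1))) (by fun_prop)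
  have h2 : ∫⁻ x, g x ∂((p.pathLaw z).map (Preorder.frestrictLe k) ⊗ₘ p.historyKernel k)
      = ∫⁻ ω, ∫⁻ y, f (ω k) y ∂p.stepLaw (ω k) ∂p.pathLaw z := by
    rw [Measure.lintegral_compProd hg, lintegral_map hg.lintegral_kernel_prod_right' (by fun_prop)]
    rfl
  rw [← h2]
  refine h1.symm.trans ?_
  congr 1
  exact key.symm

theorem map_pathLaw_zero (z : ℕ × ℕ) : (p.pathLaw z).map (fun ω => ω 0) = Measure.dirac z := by
  have h1 : p.pathLaw z = Kernel.traj (X := fun _ => ℕ × ℕ) p.historyKernel 0 (fun _ => z) := by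
    unfold pathLaw Kernel.trajMeasure
    rw [Measure.map_dirac' (by fun_prop), Measure.dirac_bind (Kernel.measurable _)]
    rfl
  have h2 := Kernel.traj_map_frestrictLe_apply (X := fun _ => ℕ × ℕ) (κ := p.historyKernel) 0 0
    (fun _ => z)
  rw [← h1, Kernel.partialTraj_self, Kernel.id_apply] at h2
  have h3 : (fun ω : ℕ → ℕ × ℕ => ω 0) =
      (fun x : (Π _ : Finset.Iic 0, ℕ × ℕ) => x ⟨0, Finset.mem_Iic.2 le_rfl⟩) ∘
        (Preorder.frestrictLe (π := fun _ => ℕ × ℕ) 0) := rfl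
  rw [h3, ← Measure.map_map (by fun_prop) (by fun_prop), h2, Measure.map_dirac' (by fun_prop)]

/-- The law at time `k` of the walk started at `z`. -/
noncomputable def occ (k : ℕ) (z w : ℕ × ℕ) : ℝ≥0∞ := p.pathLaw z {ω | ω k = w}

theorem measurableSet_visit (k : ℕ) (w : ℕ × ℕ) : MeasurableSet {ω : ℕ → ℕ × ℕ | ω k = w} :=
  measurableSet_eq_fun (measurable_pi_apply k) measurable_const

theorem occ_ne_top (k : ℕ) (z w : ℕ × ℕ) : p.occ k z w ≠ ⊤ := measure_ne_top _ _

theorem lintegral_visit (k : ℕ) (z w : ℕ × ℕ) :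
    ∫⁻ ω, (if ω k = w then (1 : ℝ≥0∞) else 0) ∂p.pathLaw z = p.occ k z w := by
  classical
  rw [occ, ← lintegral_indicator_one (measurableSet_visit k w)]
  simp [Set.indicator_apply]

theorem measurable_visit (k : ℕ) (w : ℕ × ℕ) :
    Measurable fun ω : ℕ → ℕ × ℕ => (if ω k = w then (1 : ℝ≥0∞) else 0) :=
  Measurable.ite (measurableSet_visit k w) measurable_const measurable_const

theorem green_eq_tsum (z w : ℕ × ℕ) : p.green z w = ∑' k, p.occ k z w := by
  unfold green
  rw [lintegral_tsum fun k => ?_]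
  · refine tsum_congr fun k => ?_
    rw [← lintegral_visit]
  · convert! (measurable_visit k w).aemeasurable

theorem occ_zero (z w : ℕ × ℕ) : p.occ 0 z w = if z = w then 1 else 0 := by
  have h := congrArg (fun μ => μ {w}) (p.map_pathLaw_zero z)
  rw [Measure.map_apply (by fun_prop) (measurableSet_singleton w),
    Measure.dirac_apply' _ (measurableSet_singleton w)] at h
  unfold occ
  rw [show {ω : ℕ → ℕ × ℕ | ω 0 = w} = (fun ω => ω 0) ⁻¹' {w} from rfl, h]
  simp [Set.indicator_apply]

theorem occ_succ (k : ℕ) (z w : ℕ × ℕ) :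
    p.occ (k + 1) z w = ∫⁻ ω, p.stepLaw (ω k) {w} ∂p.pathLaw z := by
  rw [← lintegral_visit]
  refine (p.lintegral_pathLaw_consecutive z k fun _ y => if y = w then 1 else 0).trans ?_
  refine lintegral_congr fun ω => ?_
  rw [← lintegral_indicator_one (measurableSet_singleton w)]
  simp [Set.indicator_apply]

theorem stepLaw_of_axis {z : ℕ × ℕ} (h : z.1 = 0 ∨ z.2 = 0) (w : ℕ × ℕ) :
    p.stepLaw z {w} = if z = w then 1 else 0 := by
  rw [stepLaw, if_pos h, Measure.dirac_apply' _ (measurableSet_singleton w)]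
  simp [Set.indicator_apply]

theorem stepLaw_succ (x y : ℕ) (w : ℕ × ℕ) :
    p.stepLaw (x + 1, y + 1) {w} = p.p10 * (if (x + 2, y + 1) = w then 1 else 0)
      + p.pm10 * (if (x, y + 1) = w then 1 else 0)
      + p.p01 * (if (x + 1, y + 2) = w then 1 else 0)
      + p.p0m1 * (if (x + 1, y) = w then 1 else 0) := by
  rw [stepLaw, if_neg (by simp)]
  simp [Set.indicator_apply, Measure.dirac_apply' _ (measurableSet_singleton w)]

/-- The law at time `k` restricted to the interior. As the axes are absorbing, this is also the law
at time `k` of the walk killed when it reaches them. -/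
noncomputable def killedOcc (k : ℕ) (z w : ℕ × ℕ) : ℝ≥0∞ :=
  if w.1 = 0 ∨ w.2 = 0 then 0 else p.occ k z w

/-- Forward equation at an interior point. -/
theorem occ_succ_interior (k : ℕ) (z : ℕ × ℕ) (i j : ℕ) :
    p.occ (k + 1) z (i + 1, j + 1) = p.p10 * p.killedOcc k z (i, j + 1)
      + p.pm10 * p.killedOcc k z (i + 2, j + 1)
      + p.p01 * p.killedOcc k z (i + 1, j)
      + p.p0m1 * p.killedOcc k z (i + 1, j + 2) := by
  have hk (w : ℕ × ℕ) : p.killedOcc k z w =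
      ∫⁻ ω, (if w.1 = 0 ∨ w.2 = 0 then 0 else if ω k = w then 1 else 0) ∂p.pathLaw z := by
    unfold killedOcc
    split_ifs
    · simp
    · rw [lintegral_visit]
  have hm (w : ℕ × ℕ) : Measurable fun ω : ℕ → ℕ × ℕ =>
      (if w.1 = 0 ∨ w.2 = 0 then (0 : ℝ≥0∞) else if ω k = w then 1 else 0) := by
    split_ifs
    · exact measurable_const
    · exact measurable_visit k w
  rw [occ_succ, hk, hk, hk, hk, ← lintegral_const_mul _ (hm _), ← lintegral_const_mul _ (hm _),
    ← lintegral_const_mul _ (hm _), ← lintegral_const_mul _ (hm _),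
    ← lintegral_add_right _ ((hm _).const_mul _), ← lintegral_add_right _ ((hm _).const_mul _),
    ← lintegral_add_right _ ((hm _).const_mul _)]
  refine lintegral_congr fun ω => ?_
  obtain ⟨x, y⟩ := ω k
  rcases x with _ | x
  · rw [p.stepLaw_of_axis (Or.inl rfl)]
    simp [Prod.ext_iff]
    omega
  rcases y with _ | y
  · rw [p.stepLaw_of_axis (Or.inr rfl)]
    simp [Prod.ext_iff]
    omega
  rw [stepLaw_succ]
  congr 1
  · congr 1
    · congr 1
      · grind
      · grind
    · grind
  · grind

/-- An axis point charged at time `k + 1` was either already occupied at time `k`, or entered from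
its only interior neighbour. -/
theorem occ_succ_horizontal_axis (k : ℕ) (z : ℕ × ℕ) (i : ℕ) :
    p.occ (k + 1) z (i + 1, 0) = p.occ k z (i + 1, 0) + p.p0m1 * p.occ k z (i + 1, 1) := by
  rw [occ_succ, ← lintegral_visit, ← lintegral_visit,
    ← lintegral_const_mul _ (measurable_visit _ _),
    ← lintegral_add_left (measurable_visit _ _)]
  refine lintegral_congr fun ω => ?_
  obtain ⟨x, y⟩ := ω k
  rcases x with _ | x
  · rw [p.stepLaw_of_axis (Or.inl rfl)]
    simp [Prod.ext_iff]
  rcases y with _ | y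
  · rw [p.stepLaw_of_axis (Or.inr rfl)]
    simp [Prod.ext_iff]
  rw [stepLaw_succ]
  simp [Prod.ext_iff]

theorem occ_succ_vertical_axis (k : ℕ) (z : ℕ × ℕ) (j : ℕ) :
    p.occ (k + 1) z (0, j + 1) = p.occ k z (0, j + 1) + p.pm10 * p.occ k z (1, j + 1) := by
  rw [occ_succ, ← lintegral_visit, ← lintegral_visit,
    ← lintegral_const_mul _ (measurable_visit _ _),
    ← lintegral_add_left (measurable_visit _ _)]
  refine lintegral_congr fun ω => ?_
  obtain ⟨x, y⟩ := ω k
  rcases x with _ | x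
  · rw [p.stepLaw_of_axis (Or.inl rfl)]
    simp [Prod.ext_iff]
  rcases y with _ | y
  · rw [p.stepLaw_of_axis (Or.inr rfl)]
    simp [Prod.ext_iff]
  rw [stepLaw_succ]
  simp [Prod.ext_iff]

/-- Axis points are almost surely never left. -/
theorem ae_absorbed (z : ℕ × ℕ) {w : ℕ × ℕ} (hw : w.1 = 0 ∨ w.2 = 0) :
    ∀ᵐ ω ∂p.pathLaw z, ∀ k, ω k = w → ω (k + 1) = w := by
  rw [ae_all_iff]
  intro k
  let f : ℕ × ℕ → ℕ × ℕ → ℝ≥0∞ := fun x y => if x = w ∧ y ≠ w then 1 else 0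
  have h : ∫⁻ ω, f (ω k) (ω (k + 1)) ∂p.pathLaw z = 0 := by
    rw [p.lintegral_pathLaw_consecutive z k f]
    refine (lintegral_congr fun ω => ?_).trans lintegral_zero
    by_cases hx : ω k = w
    · rw [hx, stepLaw, if_pos hw, lintegral_dirac]
      simp [f]
    · simp [f, hx]
  have hf : Measurable fun ω : ℕ → ℕ × ℕ => f (ω k) (ω (k + 1)) :=
    (measurable_of_countable (Function.uncurry f)).comp
      (g := Function.uncurry f) (f := fun ω : ℕ → ℕ × ℕ => (ω k, ω (k + 1))) (by fun_prop)
  rw [lintegral_eq_zero_iff hf] at h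
  filter_upwards [h] with ω hω hk
  by_contra hne
  simp [f, hk, hne] at hω

/-- Since an axis point `w` is absorbing, the probability of hitting it is the increasing limit of
the probabilities of sitting there at time `k`. -/
theorem hitProb_eq_iSup (z : ℕ × ℕ) {w : ℕ × ℕ} (hw : w.1 = 0 ∨ w.2 = 0) :
    p.hitProb z w = ⨆ k, p.occ k z w := by
  have hU : {ω : ℕ → ℕ × ℕ | ∃ k, ω k = w} = ⋃ k, {ω | ω k = w} := by
    ext; simp
  rw [hitProb, hU, measure_iUnion_eq_iSup_accumulate]
  refine iSup_congr fun k => measure_congr ?_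
  filter_upwards [p.ae_absorbed z hw] with ω hω
  have hmono : ∀ l n, ω l = w → ω (l + n) = w := by
    intro l n hl
    induction n with
    | zero => exact hl
    | succ n ih => exact hω _ ih
  refine propext ⟨fun h => ?_, fun h => Set.mem_accumulate.2 ⟨k, le_rfl, h⟩⟩
  obtain ⟨l, hlk, hl⟩ := Set.mem_accumulate.1 h
  have := hmono l (k - l) hl
  rwa [Nat.add_sub_cancel' hlk] at this

theorem hitProb_eq_of_occ_succ {z w v : ℕ × ℕ} (hw : w.1 = 0 ∨ w.2 = 0) {c : ℝ≥0∞}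
    (h : ∀ k, p.occ (k + 1) z w = p.occ k z w + c * p.occ k z v) :
    p.hitProb z w = (if z = w then 1 else 0) + c * p.green z v := by
  have hsum : ∀ N, p.occ N z w
      = (if z = w then 1 else 0) + c * ∑ k ∈ Finset.range N, p.occ k z v := by
    intro N
    induction N with
    | zero => simp [occ_zero]
    | succ N ih => rw [h, ih, Finset.sum_range_succ, mul_add, add_assoc]
  rw [hitProb_eq_iSup p z hw, green_eq_tsum, ENNReal.tsum_eq_iSup_nat, ENNReal.mul_iSup,
    ENNReal.add_iSup]
  exact iSup_congr hsum

theorem hitProb_horizontal_axis (z : ℕ × ℕ) (i : ℕ) :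
    p.hitProb z (i + 1, 0)
      = (if z = (i + 1, 0) then 1 else 0) + p.p0m1 * p.green z (i + 1, 1) :=
  p.hitProb_eq_of_occ_succ (Or.inr rfl) fun k => p.occ_succ_horizontal_axis k z i

theorem hitProb_vertical_axis (z : ℕ × ℕ) (j : ℕ) :
    p.hitProb z (0, j + 1)
      = (if z = (0, j + 1) then 1 else 0) + p.pm10 * p.green z (1, j + 1) :=
  p.hitProb_eq_of_occ_succ (Or.inl rfl) fun k => p.occ_succ_vertical_axis k z j

end JumpProb
end QuadrantWalk

/-! ### The killed transition operator -/

namespace QuadrantWalk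

/-- The transition operator of the driftless walk killed on the axes: `a` is the probability of each
horizontal jump and `b` that of each vertical one. It is symmetric, so it serves as the forward and
as the backward operator. -/
def killedStep (a b : ℝ) (f : ℕ × ℕ → ℝ) : ℕ × ℕ → ℝ
  | (0, _) => 0
  | (_ + 1, 0) => 0
  | (i + 1, j + 1) =>
    a * (f (i, j + 1) + f (i + 2, j + 1)) + b * (f (i + 1, j) + f (i + 1, j + 2))

section

variable {a b : ℝ}

theorem killedStep_of_axis (f : ℕ × ℕ → ℝ) {z : ℕ × ℕ} (hz : z.1 = 0 ∨ z.2 = 0) :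
    killedStep a b f z = 0 := by
  obtain ⟨_ | i, _ | j⟩ := z <;> simp_all [killedStep]

theorem killedStep_mono (ha : 0 < a) (hb : 0 < b) {f g : ℕ × ℕ → ℝ} (h : ∀ z, f z ≤ g z)
    (z : ℕ × ℕ) : killedStep a b f z ≤ killedStep a b g z := by
  obtain ⟨_ | i, _ | j⟩ := z <;> simp only [killedStep, le_refl]
  gcongr <;> exact h _

theorem killedStep_smul (c : ℝ) (f : ℕ × ℕ → ℝ) (z : ℕ × ℕ) :
    killedStep a b (fun z => c * f z) z = c * killedStep a b f z := by
  obtain ⟨_ | i, _ | j⟩ := z <;> simp only [killedStep, mul_zero]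
  ring

theorem killedStep_sub (f g : ℕ × ℕ → ℝ) (z : ℕ × ℕ) :
    killedStep a b (fun z => f z - g z) z = killedStep a b f z - killedStep a b g z := by
  obtain ⟨_ | i, _ | j⟩ := z <;> simp only [killedStep, sub_zero]
  ring

theorem tendsto_killedStep {f : ℕ → ℕ × ℕ → ℝ} {g : ℕ × ℕ → ℝ}
    (h : ∀ z, Tendsto (fun N => f N z) atTop (𝓝 (g z))) (z : ℕ × ℕ) :
    Tendsto (fun N => killedStep a b (f N) z) atTop (𝓝 (killedStep a b g z)) := by
  obtain ⟨_ | i, _ | j⟩ := z <;> simp only [killedStep, tendsto_const_nhds]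
  exact (((h _).add (h _)).const_mul a).add (((h _).add (h _)).const_mul b)

/-- Bounded functions invariant under the killed walk are non-positive. By the maximum principle
such a function is below `ε (x + y)`, which is harmonic and dominates it on the axes and far
away. -/
theorem nonpos_of_killedStep_eq (ha : 0 < a) (hb : 0 < b) (hab : 2 * a + 2 * b = 1)
    {h : ℕ × ℕ → ℝ} (h1 : ∀ z, h z ≤ 1) (hh : ∀ z, killedStep a b h z = h z) (z : ℕ × ℕ) :
    h z ≤ 0 := by
  by_contra! hz
  have hax : ∀ w : ℕ × ℕ, w.1 = 0 ∨ w.2 = 0 → h w = 0 := fun w hw => by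
    rw [← hh, killedStep_of_axis h hw]
  obtain ⟨ε, hε, hεz⟩ : ∃ ε : ℝ, 0 < ε ∧ ε * (z.1 + z.2 : ℝ) < h z := by
    refine ⟨h z / (z.1 + z.2 + 1), by positivity, ?_⟩
    rw [div_mul_eq_mul_div, div_lt_iff₀ (by positivity)]
    nlinarith
  let d : ℕ × ℕ → ℝ := fun w => h w - ε * (w.1 + w.2)
  have hd0 : ∀ w : ℕ × ℕ, w.1 = 0 ∨ w.2 = 0 → d w ≤ 0 := fun w hw => by
    simp only [d, hax w hw]
    have : (0 : ℝ) ≤ ε * (w.1 + w.2) := by positivity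
    linarith
  obtain ⟨K, hK⟩ := exists_nat_ge (1 / ε)
  have hK' : 1 ≤ ε * K := by rwa [div_le_iff₀' hε] at hK
  have hdK : ∀ w : ℕ × ℕ, K ≤ w.1 + w.2 → d w ≤ 0 := fun w hw => by
    have h2 : (K : ℝ) ≤ w.1 + w.2 := by exact_mod_cast hw
    have h3 := mul_le_mul_of_nonneg_left h2 hε.le
    have := h1 w
    simp only [d]
    linarith
  have hdz : 0 < d z := by simp only [d]; linarith
  let s : Finset (ℕ × ℕ) := Finset.range K ×ˢ Finset.range K
  have hs : ∀ w, 0 < d w → w ∈ s := fun w hw => by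
    have : w.1 + w.2 < K := by
      by_contra! hc
      exact absurd hw (hdK w hc).not_gt
    simp only [s, Finset.mem_product, Finset.mem_range]
    omega
  obtain ⟨m, -, hm⟩ := s.exists_max_image d ⟨z, hs z hdz⟩
  have hmpos : 0 < d m := hdz.trans_le (hm z (hs z hdz))
  have hmax : ∀ w, d w ≤ d m := fun w => by
    by_cases hw : 0 < d w
    · exact hm w (hs w hw)
    · exact (not_lt.1 hw).trans hmpos.le
  -- The maximum propagates to the left until it reaches the vertical axis.
  have hleft : ∀ x y, d (x, y) = d m → False := by
    intro x
    induction x with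
    | zero =>
      intro y hy
      exact absurd (hd0 (0, y) (Or.inl rfl)) (by rw [hy]; exact hmpos.not_ge)
    | succ x ih =>
      intro y hy
      rcases y with _ | y
      · exact absurd (hd0 (x + 1, 0) (Or.inr rfl)) (by rw [hy]; exact hmpos.not_ge)
      refine ih (y + 1) (le_antisymm (hmax _) ?_)
      have e := hh (x + 1, y + 1)
      have i2 := mul_le_mul_of_nonneg_left (hmax (x + 2, y + 1)) ha.le
      have i3 := mul_le_mul_of_nonneg_left (hmax (x + 1, y)) hb.le
      have i4 := mul_le_mul_of_nonneg_left (hmax (x + 1, y + 2)) hb.le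
      have e2 : d (x + 1, y + 1) = a * (d (x, y + 1) + d (x + 2, y + 1))
          + b * (d (x + 1, y) + d (x + 1, y + 2)) := by
        simp only [killedStep] at e
        simp only [d, ← e]
        push_cast
        linear_combination (ε * (x + y + 2)) * hab
      have i1 : a * d m ≤ a * d (x, y + 1) := by
        have : d m = (2 * a + 2 * b) * d m := by rw [hab, one_mul]
        linarith
      exact le_of_mul_le_mul_left i1 ha
  exact hleft m.1 m.2 rfl

/-- The killed walk dies almost surely. -/
theorem tendsto_killedStep_iterate_one (ha : 0 < a) (hb : 0 < b) (hab : 2 * a + 2 * b = 1)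
    (z : ℕ × ℕ) :
    Tendsto (fun N => (killedStep a b)^[N] (fun _ => 1) z) atTop (𝓝 0) := by
  set u : ℕ → ℕ × ℕ → ℝ := fun N => (killedStep a b)^[N] (fun _ => 1) with hu
  have hs : ∀ N, u (N + 1) = killedStep a b (u N) := fun N =>
    Function.iterate_succ_apply' _ _ _
  have h0 : ∀ N z, 0 ≤ u N z := by
    intro N
    induction N with
    | zero => intro z; simp [hu]
    | succ N ih =>
      rintro ⟨_ | i, _ | j⟩ <;> simp only [hs, killedStep, le_refl]
      have := ih (i, j + 1)
      have := ih (i + 2, j + 1)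
      have := ih (i + 1, j)
      have := ih (i + 1, j + 2)
      positivity
  have hstep : ∀ N z, u (N + 1) z ≤ u N z := by
    intro N
    induction N with
    | zero =>
      rintro ⟨_ | i, _ | j⟩ <;> simp only [hs, killedStep] <;> simp [hu]
      linarith
    | succ N ih =>
      intro z
      rw [hs (N + 1), hs N]
      exact killedStep_mono ha hb (fun w => by rw [← hs]; exact ih w) z
  have hanti : ∀ z, Antitone fun N => u N z := fun z => antitone_nat_of_succ_le fun N => hstep N z
  have hlim : ∀ z, Tendsto (fun N => u N z) atTop (𝓝 (⨅ N, u N z)) := fun z =>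
    tendsto_atTop_ciInf (hanti z) ⟨0, by rintro _ ⟨N, rfl⟩; exact h0 N z⟩
  have hinv : ∀ z, killedStep a b (fun z => ⨅ N, u N z) z = ⨅ N, u N z := fun z => by
    refine tendsto_nhds_unique (tendsto_killedStep hlim z) ?_
    simp only [← hs]
    exact (tendsto_add_atTop_iff_nat 1).2 (hlim z)
  have hle : ∀ z, (⨅ N, u N z) ≤ 1 := fun z =>
    (ciInf_le ⟨0, by rintro _ ⟨N, rfl⟩; exact h0 N z⟩ 0).trans (by simp [hu])
  have := nonpos_of_killedStep_eq ha hb hab hle hinv z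
  have h2 := hlim z
  rwa [le_antisymm this (le_ciInf fun N => h0 N z)] at h2

theorem tendsto_killedStep_iterate (ha : 0 < a) (hb : 0 < b) (hab : 2 * a + 2 * b = 1)
    {f : ℕ × ℕ → ℝ} {C : ℝ} (hf : ∀ z, |f z| ≤ C) (z : ℕ × ℕ) :
    Tendsto (fun N => (killedStep a b)^[N] f z) atTop (𝓝 0) := by
  have hbd : ∀ N z, |(killedStep a b)^[N] f z| ≤ C * (killedStep a b)^[N] (fun _ => 1) z := by
    intro N
    induction N with
    | zero => intro z; simpa using hf z
    | succ N ih =>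
      intro z
      rw [Function.iterate_succ_apply', Function.iterate_succ_apply', ← killedStep_smul]
      refine abs_le.2 ⟨?_, killedStep_mono ha hb (fun w => (abs_le.1 (ih w)).2) z⟩
      have := killedStep_mono ha hb (fun w => (abs_le.1 (ih w)).1) z
      simp only [neg_eq_neg_one_mul (C * _)] at this
      rw [killedStep_smul] at this
      linarith
  refine squeeze_zero_norm (hbd · z) ?_
  simpa using (tendsto_killedStep_iterate_one ha hb hab z).const_mul C

/-- A bounded solution `F` of `F = 1_z + P F` is the sum of the series `∑ Pᵏ 1_z`. -/
theorem hasSum_of_killedStep_eq (ha : 0 < a) (hb : 0 < b) (hab : 2 * a + 2 * b = 1)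
    {F : ℕ × ℕ → ℝ} {C : ℝ} (hC : ∀ w, |F w| ≤ C) {q : ℕ → ℕ × ℕ → ℝ} (hq : ∀ k w, 0 ≤ q k w)
    (hq1 : ∀ k w, q (k + 1) w = killedStep a b (q k) w)
    (hF : ∀ w, F w = q 0 w + killedStep a b F w) (w : ℕ × ℕ) :
    HasSum (fun k => q k w) (F w) := by
  rw [hasSum_iff_tendsto_nat_of_nonneg (fun k => hq k w)]
  have hsum : ∀ N w, ∑ k ∈ Finset.range N, q k w = F w - (killedStep a b)^[N] F w := by
    intro N
    induction N with
    | zero => simp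
    | succ N ih =>
      intro w
      rw [Finset.sum_range_succ', Function.iterate_succ_apply']
      have e : ∑ k ∈ Finset.range N, q (k + 1) w
          = killedStep a b (fun w => ∑ k ∈ Finset.range N, q k w) w := by
        simp only [hq1]
        obtain ⟨_ | i, _ | j⟩ := w <;> simp only [killedStep, Finset.sum_const_zero]
        simp only [Finset.sum_add_distrib, Finset.mul_sum, mul_add]
      rw [e, funext ih, killedStep_sub]
      linarith [hF w]
  simp only [hsum]
  simpa using (tendsto_killedStep_iterate ha hb hab hC w).const_sub (F w)

end

end QuadrantWalk

/-! ### The sine transform of the Green function -/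

namespace QuadrantWalk

/-- The exponential rate at which the Green function of the horizontal component decays once the
vertical component has been diagonalised by the frequency `θ`. It is the positive solution `μ` of
`cosh μ = 1 + c² (1 - cos θ)`. -/
noncomputable def decayRate (c θ : ℝ) : ℝ := 2 * Real.arsinh (c * Real.sin (θ / 2))

/-- The root in `(0, 1]` of `x + x⁻¹ = 2 + 2 c² (1 - cos θ)`. -/
noncomputable def decayFactor (c θ : ℝ) : ℝ := Real.exp (-decayRate c θ)

theorem continuous_decayFactor (c : ℝ) : Continuous (decayFactor c) := by
  unfold decayFactor decayRate
  exact Real.continuous_exp.comp (((Real.continuous_arsinh.comp (by fun_prop)).const_mul 2).neg)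

theorem decayFactor_pos (c θ : ℝ) : 0 < decayFactor c θ := Real.exp_pos _

theorem decayFactor_add_inv (c θ : ℝ) :
    decayFactor c θ + (decayFactor c θ)⁻¹ = 2 + 2 * c ^ 2 * (1 - Real.cos θ) := by
  have h1 : decayFactor c θ + (decayFactor c θ)⁻¹ = 2 * Real.cosh (decayRate c θ) := by
    rw [Real.cosh_eq, decayFactor, ← Real.exp_neg, neg_neg]
    ring
  have h2 : Real.cos θ = 2 * Real.cos (θ / 2) ^ 2 - 1 := by
    rw [← Real.cos_two_mul]; ring_nf
  rw [h1, decayRate, Real.cosh_two_mul, Real.cosh_sq, Real.sinh_arsinh, h2]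
  nlinarith [Real.sin_sq_add_cos_sq (θ / 2)]

/-- The rate is at least linear: `arsinh x ≥ log (1 + x) ≥ x / (1 + x)`, with Jordan's
inequality. -/
theorem le_decayRate {c θ : ℝ} (hc : 0 < c) (h0 : 0 ≤ θ) (hπ : θ ≤ Real.pi) :
    2 * c / (Real.pi * (1 + c)) * θ ≤ decayRate c θ := by
  have hs : θ / Real.pi ≤ Real.sin (θ / 2) := by
    have := Real.mul_le_sin (x := θ / 2) (by linarith) (by linarith)
    calc θ / Real.pi = 2 / Real.pi * (θ / 2) := by ring
      _ ≤ _ := this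
  have hs0 : 0 ≤ Real.sin (θ / 2) := le_trans (by positivity) hs
  set x := c * Real.sin (θ / 2) with hx
  have hx0 : 0 ≤ x := by positivity
  have hxc : x ≤ c := by
    have := mul_le_mul_of_nonneg_left (Real.sin_le_one (θ / 2)) hc.le
    simpa [hx] using this
  have h1 : 1 - (1 + x)⁻¹ ≤ Real.arsinh x := by
    refine (Real.one_sub_inv_le_log_of_pos (by positivity)).trans ?_
    rw [Real.arsinh]
    refine Real.log_le_log (by positivity) ?_
    have : (1 : ℝ) ≤ √(1 + x ^ 2) := Real.one_le_sqrt.2 (by nlinarith [sq_nonneg x])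
    linarith
  have h2 : x / (1 + c) ≤ 1 - (1 + x)⁻¹ := by
    have : 1 - (1 + x)⁻¹ = x / (1 + x) := by field_simp; ring
    rw [this]
    gcongr
  have h3 : c * (θ / Real.pi) / (1 + c) ≤ x / (1 + c) := by rw [hx]; gcongr
  calc 2 * c / (Real.pi * (1 + c)) * θ = 2 * (c * (θ / Real.pi) / (1 + c)) := by
        field_simp
    _ ≤ _ := by unfold decayRate; linarith

theorem decayFactor_le_exp {c θ : ℝ} (hc : 0 < c) (h0 : 0 ≤ θ) (hπ : θ ≤ Real.pi) :
    decayFactor c θ ≤ Real.exp (-(2 * c / (Real.pi * (1 + c)) * θ)) :=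
  Real.exp_le_exp.2 (neg_le_neg (le_decayRate hc h0 hπ))

theorem decayFactor_lt_one {c θ : ℝ} (hc : 0 < c) (h0 : 0 < θ) (hπ : θ ≤ Real.pi) :
    decayFactor c θ < 1 := by
  refine (decayFactor_le_exp hc h0.le hπ).trans_lt (Real.exp_lt_one_iff.2 ?_)
  have := Real.pi_pos
  have : 0 < 2 * c / (Real.pi * (1 + c)) * θ := by positivity
  linarith

theorem decayFactor_le_one {c θ : ℝ} (hc : 0 < c) (h0 : 0 ≤ θ) (hπ : θ ≤ Real.pi) :
    decayFactor c θ ≤ 1 := by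
  refine (decayFactor_le_exp hc h0 hπ).trans (Real.exp_le_one_iff.2 ?_)
  have := Real.pi_pos
  have : 0 ≤ 2 * c / (Real.pi * (1 + c)) * θ := by positivity
  linarith

/-- The quotient `x (x ^ |n - i| - x ^ (n + i)) / (1 - x ^ 2)`, written as a geometric sum so that
it is visibly continuous at `x = 1`. It is the Green function at `i` of the three-term recurrence
`(x + x⁻¹) f i - f (i - 1) - f (i + 1)` on the half-line, with a unit source at `n`. -/
def halfLineGreen (x : ℝ) (n i : ℕ) : ℝ :=
  ∑ k ∈ Finset.range (min n i), x ^ (max n i - min n i + 1 + 2 * k)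

theorem halfLineGreen_zero (x : ℝ) (n : ℕ) : halfLineGreen x n 0 = 0 := by
  simp [halfLineGreen]

theorem one_sub_sq_mul_halfLineGreen_of_le (x : ℝ) (i d : ℕ) :
    (1 - x ^ 2) * halfLineGreen x (i + d) i = x * (x ^ d - x ^ (i + d + i)) := by
  have h := mul_geom_sum (x ^ 2) i
  rw [halfLineGreen, min_eq_right (by omega), max_eq_left (by omega), Nat.add_sub_cancel_left]
  simp_rw [pow_add x (d + 1), ← Finset.mul_sum, pow_mul x 2]
  linear_combination (-x ^ (d + 1)) * h

theorem one_sub_sq_mul_halfLineGreen_of_ge (x : ℝ) (n d : ℕ) :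
    (1 - x ^ 2) * halfLineGreen x n (n + d) = x * (x ^ d - x ^ (n + d + n)) := by
  rw [← one_sub_sq_mul_halfLineGreen_of_le x n d]
  simp only [halfLineGreen, min_comm, max_comm]

theorem halfLineGreen_recurrence {x : ℝ} (h0 : 0 < x) (h1 : x < 1) (n i : ℕ) :
    (x + x⁻¹) * halfLineGreen x n (i + 1)
      = halfLineGreen x n i + halfLineGreen x n (i + 2) + if n = i + 1 then 1 else 0 := by
  have hne : 1 - x ^ 2 ≠ 0 := by nlinarith
  apply mul_left_cancel₀ hne
  have hx : x ≠ 0 := h0.ne'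
  have e : (1 - x ^ 2) * ((x + x⁻¹) * halfLineGreen x n (i + 1))
      = (x + x⁻¹) * ((1 - x ^ 2) * halfLineGreen x n (i + 1)) := by ring
  rw [e, mul_add, mul_add]
  rcases lt_trichotomy n (i + 1) with h | h | h
  · obtain ⟨d, rfl⟩ := Nat.exists_eq_add_of_le (Nat.lt_succ_iff.1 h)
    rw [if_neg (by omega), add_assoc n d 1, add_assoc n d 2,
      one_sub_sq_mul_halfLineGreen_of_ge, one_sub_sq_mul_halfLineGreen_of_ge,
      one_sub_sq_mul_halfLineGreen_of_ge]
    field_simp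
    ring
  · subst h
    have e1 := one_sub_sq_mul_halfLineGreen_of_le x (i + 1) 0
    have e2 := one_sub_sq_mul_halfLineGreen_of_le x i 1
    have e3 := one_sub_sq_mul_halfLineGreen_of_ge x (i + 1) 1
    simp only [add_zero] at e1
    rw [if_pos rfl, e1, e2, e3]
    field_simp
    ring
  · obtain ⟨d, rfl⟩ := Nat.exists_eq_add_of_le (Nat.succ_le_of_lt h)
    have e1 := one_sub_sq_mul_halfLineGreen_of_le x (i + 1) (d + 1)
    have e2 := one_sub_sq_mul_halfLineGreen_of_le x i (d + 2)
    have e3 := one_sub_sq_mul_halfLineGreen_of_le x (i + 2) d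
    rw [show (i + 1).succ + d = i + 1 + (d + 1) by omega, if_neg (by omega), e1,
      show i + 1 + (d + 1) = i + (d + 2) by omega, e2,
      show i + (d + 2) = i + 2 + d by omega, e3]
    field_simp
    ring

theorem halfLineGreen_nonneg {x : ℝ} (h0 : 0 ≤ x) (n i : ℕ) : 0 ≤ halfLineGreen x n i :=
  Finset.sum_nonneg fun _ _ => pow_nonneg h0 _

theorem halfLineGreen_le {x : ℝ} (h0 : 0 ≤ x) (h1 : x ≤ 1) (n i : ℕ) :
    halfLineGreen x n i ≤ n := by
  calc halfLineGreen x n i ≤ ∑ _k ∈ Finset.range (min n i), (1 : ℝ) :=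
        Finset.sum_le_sum fun _ _ => pow_le_one₀ h0 h1
    _ = (min n i : ℕ) := by simp
    _ ≤ n := by exact_mod_cast min_le_left n i

theorem continuous_halfLineGreen (n i : ℕ) : Continuous fun x => halfLineGreen x n i := by
  unfold halfLineGreen
  fun_prop

theorem integral_sin_mul_sin {m j : ℕ} (hm : 0 < m) :
    ∫ θ in (0 : ℝ)..Real.pi, Real.sin (m * θ) * Real.sin (j * θ)
      = if m = j then Real.pi / 2 else 0 := by
  have hcos : ∀ k : ℤ, k ≠ 0 → ∫ θ in (0 : ℝ)..Real.pi, Real.cos (k * θ) = 0 := by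
    intro k hk
    have hk' : (k : ℝ) ≠ 0 := by exact_mod_cast hk
    rw [intervalIntegral.integral_comp_mul_left (fun x => Real.cos x) hk', integral_cos]
    simp [Real.sin_int_mul_pi]
  have e : ∀ θ : ℝ, Real.sin (m * θ) * Real.sin (j * θ)
      = (1 / 2) * Real.cos (((m : ℤ) - j : ℤ) * θ)
        - (1 / 2) * Real.cos (((m : ℤ) + j : ℤ) * θ) := by
    intro θ
    push_cast
    rw [sub_mul, add_mul, Real.cos_sub, Real.cos_add]
    ring
  simp only [e]
  rw [intervalIntegral.integral_sub (by apply Continuous.intervalIntegrable; fun_prop)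
    (by apply Continuous.intervalIntegrable; fun_prop), intervalIntegral.integral_const_mul,
    intervalIntegral.integral_const_mul, hcos ((m : ℤ) + j) (by omega)]
  split_ifs with h
  · subst h
    simp
    ring
  · rw [hcos _ (by omega)]
    simp

/-- The Green function of the driftless killed walk, as a sine transform in the vertical variable:
`a` is the probability of each horizontal jump, `c ^ 2` the ratio of the vertical to the horizontal
jump probabilities, and `(n, m)` the starting point. -/
noncomputable def sineGreen (a c : ℝ) (n m : ℕ) (w : ℕ × ℕ) : ℝ :=
  2 / (Real.pi * a) * ∫ θ in (0 : ℝ)..Real.pi,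
    Real.sin (m * θ) * Real.sin (w.2 * θ) * halfLineGreen (decayFactor c θ) n w.1

theorem continuous_sineGreen_integrand (c : ℝ) (n m i j : ℕ) : Continuous fun θ : ℝ =>
    Real.sin (m * θ) * Real.sin (j * θ) * halfLineGreen (decayFactor c θ) n i := by
  have := (continuous_halfLineGreen n i).comp (continuous_decayFactor c)
  exact Continuous.mul (by fun_prop) this

theorem abs_sineGreen_le {a c : ℝ} (ha : 0 < a) (hc : 0 < c) (n m : ℕ) (w : ℕ × ℕ) :
    |sineGreen a c n m w| ≤ 2 / (Real.pi * a) * (n * Real.pi) := by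
  have hπ := Real.pi_pos
  rw [sineGreen, abs_mul, abs_of_pos (by positivity : 0 < 2 / (Real.pi * a))]
  gcongr
  have h := intervalIntegral.norm_integral_le_of_norm_le_const (a := 0) (b := Real.pi)
    (C := (n : ℝ))
    (f := fun θ => Real.sin (m * θ) * Real.sin (w.2 * θ) * halfLineGreen (decayFactor c θ) n w.1)
    fun θ hθ => ?_
  · rwa [sub_zero, abs_of_pos hπ] at h
  · rw [Set.uIoc_of_le hπ.le] at hθ
    have hp := (decayFactor_pos c θ).le
    rw [norm_mul, norm_mul, Real.norm_eq_abs, Real.norm_eq_abs, Real.norm_eq_abs,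
      abs_of_nonneg (halfLineGreen_nonneg hp n w.1)]
    have h1 := halfLineGreen_le hp (decayFactor_le_one hc hθ.1.le hθ.2) n w.1
    have h2 : |Real.sin (m * θ)| * |Real.sin (w.2 * θ)| ≤ 1 :=
      mul_le_one₀ (Real.abs_sin_le_one _) (abs_nonneg _) (Real.abs_sin_le_one _)
    calc _ ≤ 1 * (n : ℝ) := mul_le_mul h2 h1 (halfLineGreen_nonneg hp n w.1) zero_le_one
      _ = n := one_mul _

/-- `sineGreen` solves the Poisson equation of the killed walk: the recurrence for `halfLineGreen`
cancels all terms but the source, and orthogonality of the sines makes the source a unit mass. -/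
theorem sineGreen_eq_killedStep {a b c : ℝ} (ha : 0 < a) (hc : 0 < c) (hab : 2 * a + 2 * b = 1)
    (hcb : a * c ^ 2 = b) {n m : ℕ} (hn : 0 < n) (hm : 0 < m) (w : ℕ × ℕ) :
    sineGreen a c n m w = (if w = (n, m) then 1 else 0) + killedStep a b (sineGreen a c n m) w := by
  have hπ := Real.pi_pos
  obtain ⟨_ | i, j⟩ := w
  · rw [killedStep_of_axis _ (Or.inl rfl), if_neg (by simp; omega)]
    simp [sineGreen, halfLineGreen_zero]
  rcases j with _ | j
  · rw [killedStep_of_axis _ (Or.inr rfl), if_neg (by simp; omega)]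
    simp [sineGreen]
  let K : ℕ → ℕ → ℝ → ℝ := fun i j θ =>
    Real.sin (m * θ) * Real.sin (j * θ) * halfLineGreen (decayFactor c θ) n i
  have hK : ∀ i j, IntervalIntegrable (K i j) volume 0 Real.pi := fun i j =>
    (continuous_sineGreen_integrand c n m i j).intervalIntegrable _ _
  have hs : IntervalIntegrable (fun θ : ℝ => Real.sin (m * θ) * Real.sin ((j + 1 : ℕ) * θ))
      volume 0 Real.pi := by
    apply Continuous.intervalIntegrable; fun_prop
  have hpt : Set.EqOn (K (i + 1) (j + 1)) (fun θ =>
      (a * (if n = i + 1 then 1 else 0)) * (Real.sin (m * θ) * Real.sin ((j + 1 : ℕ) * θ))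
        + (a * (K i (j + 1) θ + K (i + 2) (j + 1) θ)
          + b * (K (i + 1) j θ + K (i + 1) (j + 2) θ))) (Set.uIcc 0 Real.pi) := by
    intro θ hθ
    rw [Set.uIcc_of_le hπ.le] at hθ
    -- At `θ = 0` the two characteristic roots coincide, but there the sines vanish.
    rcases hθ.1.eq_or_lt with h0 | h0
    · simp [K, ← h0]
    have hr := halfLineGreen_recurrence (decayFactor_pos c θ) (decayFactor_lt_one hc h0 hθ.2) n i
    rw [decayFactor_add_inv] at hr
    have hsin : Real.sin ((j : ℕ) * θ) + Real.sin ((j + 2 : ℕ) * θ)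
        = 2 * Real.cos θ * Real.sin ((j + 1 : ℕ) * θ) := by
      rw [show ((j : ℕ) : ℝ) * θ = (j + 1 : ℕ) * θ - θ by push_cast; ring,
        show ((j + 2 : ℕ) : ℝ) * θ = (j + 1 : ℕ) * θ + θ by push_cast; ring,
        Real.sin_sub, Real.sin_add]
      ring
    simp only [K]
    set s := Real.sin ((j + 1 : ℕ) * θ)
    set H := halfLineGreen (decayFactor c θ) n (i + 1)
    set S := Real.sin (m * θ)
    linear_combination a * S * s * hr - b * S * H * hsin - S * s * H * hab
      - 2 * S * s * H * (1 - Real.cos θ) * hcb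
  have hint := intervalIntegral.integral_congr (μ := volume) hpt
  rw [intervalIntegral.integral_add (hs.const_mul _)
      ((((hK _ _).add (hK _ _)).const_mul _).add (((hK _ _).add (hK _ _)).const_mul _)),
    intervalIntegral.integral_add (((hK _ _).add (hK _ _)).const_mul _)
      (((hK _ _).add (hK _ _)).const_mul _),
    intervalIntegral.integral_const_mul, intervalIntegral.integral_const_mul,
    intervalIntegral.integral_const_mul, intervalIntegral.integral_add (hK _ _) (hK _ _),
    intervalIntegral.integral_add (hK _ _) (hK _ _), integral_sin_mul_sin hm] at hint
  simp only [killedStep, sineGreen]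
  change 2 / (Real.pi * a) * (∫ θ in (0 : ℝ)..Real.pi, K (i + 1) (j + 1) θ) =
    _ + (a * (2 / (Real.pi * a) * (∫ θ in (0 : ℝ)..Real.pi, K i (j + 1) θ)
        + 2 / (Real.pi * a) * (∫ θ in (0 : ℝ)..Real.pi, K (i + 2) (j + 1) θ))
      + b * (2 / (Real.pi * a) * (∫ θ in (0 : ℝ)..Real.pi, K (i + 1) j θ)
        + 2 / (Real.pi * a) * (∫ θ in (0 : ℝ)..Real.pi, K (i + 1) (j + 2) θ)))
  rw [hint]
  have hif : (if (i + 1, j + 1) = (n, m) then (1 : ℝ) else 0)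
      = (if n = i + 1 then 1 else 0) * (if m = j + 1 then 1 else 0) := by
    by_cases h1 : n = i + 1 <;> by_cases h2 : m = j + 1 <;> simp [h1, h2, eq_comm]
  have hif2 : (if m = j + 1 then Real.pi / 2 else 0)
      = Real.pi / 2 * (if m = j + 1 then 1 else 0) := by simp
  rw [hif, hif2]
  field_simp

namespace JumpProb

variable (p : JumpProb)

theorem green_eq_zero_of_axis {z w : ℕ × ℕ} (hz : z.1 = 0 ∨ z.2 = 0)
    (hw : 0 < w.1 ∧ 0 < w.2) : p.green z w = 0 := by
  obtain ⟨i, j⟩ := w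
  obtain ⟨i, rfl⟩ := Nat.exists_eq_succ_of_ne_zero hw.1.ne'
  obtain ⟨j, rfl⟩ := Nat.exists_eq_succ_of_ne_zero hw.2.ne'
  have h : ∀ k, ∀ w : ℕ × ℕ, p.killedOcc k z w = 0 := by
    intro k
    induction k with
    | zero =>
      intro w
      rw [killedOcc, occ_zero]
      split_ifs <;> first | rfl | (subst_vars; contradiction)
    | succ k ih =>
      rintro ⟨_ | i, _ | j⟩
      iterate 3 simp [killedOcc]
      rw [killedOcc, if_neg (by simp), occ_succ_interior]
      simp [ih]
  rw [green_eq_tsum, ENNReal.tsum_eq_zero]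
  intro k
  simpa [killedOcc] using h k (i + 1, j + 1)

/-- A bounded solution of the killed Poisson equation with source at `z` is the Green function. -/
theorem green_eq_of_killedStep (hX : p.driftX = 0) (hY : p.driftY = 0) {z : ℕ × ℕ}
    (hz : 0 < z.1 ∧ 0 < z.2) {F : ℕ × ℕ → ℝ} {C : ℝ} (hC : ∀ w, |F w| ≤ C)
    (hF : ∀ w, F w = (if w = z then 1 else 0) + killedStep p.p10 p.p01 F w)
    {w : ℕ × ℕ} (hw : 0 < w.1 ∧ 0 < w.2) :
    p.green z w = ENNReal.ofReal (F w) := by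
  have hX' : p.pm10 = p.p10 := by
    have : (p.p10 : ℝ) - p.pm10 = 0 := hX
    exact_mod_cast (sub_eq_zero.1 this).symm
  have hY' : p.p0m1 = p.p01 := by
    have : (p.p01 : ℝ) - p.p0m1 = 0 := hY
    exact_mod_cast (sub_eq_zero.1 this).symm
  have ha : (0 : ℝ) < p.p10 := by exact_mod_cast pos_iff_ne_zero.2 p.p10_ne
  have hb : (0 : ℝ) < p.p01 := by exact_mod_cast pos_iff_ne_zero.2 p.p01_ne
  have hab : 2 * (p.p10 : ℝ) + 2 * p.p01 = 1 := by
    have h := p.sum_eq_one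
    rw [hX', hY'] at h
    have h' : (p.p10 : ℝ) + p.p10 + p.p01 + p.p01 = 1 := by exact_mod_cast h
    linarith
  have hfin : ∀ k w, p.killedOcc k z w ≠ ⊤ := fun k w => by
    unfold killedOcc
    split_ifs
    · simp
    · exact p.occ_ne_top k z w
  let q : ℕ → ℕ × ℕ → ℝ := fun k w => (p.killedOcc k z w).toReal
  have hsum := hasSum_of_killedStep_eq (q := q) ha hb hab hC (fun _ _ => ENNReal.toReal_nonneg)
    (by
      intro k w
      obtain ⟨_ | i, _ | j⟩ := w
      iterate 3 simp [q, killedOcc, killedStep]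
      have e : p.killedOcc (k + 1) z (i + 1, j + 1) = p.occ (k + 1) z (i + 1, j + 1) := by
        simp [killedOcc]
      simp only [q, killedStep]
      rw [e, occ_succ_interior, hX', hY', ENNReal.toReal_add, ENNReal.toReal_add,
        ENNReal.toReal_add]
      · simp only [ENNReal.toReal_mul, ENNReal.coe_toReal]
        ring
      all_goals
        simp [ENNReal.mul_ne_top, hfin])
    (by
      intro w
      rw [hF w]
      congr 1
      simp only [q, killedOcc, occ_zero]
      by_cases h : w = z
      · subst h
        rw [if_pos rfl, if_neg (by omega), if_pos rfl]
        simp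
      · rw [if_neg h]
        simp [Ne.symm h]) w
  have hqw : ∀ k, p.occ k z w = ENNReal.ofReal (q k w) := fun k => by
    simp only [q]
    rw [ENNReal.ofReal_toReal (hfin k w), killedOcc, if_neg (by omega)]
  rw [green_eq_tsum]
  simp only [hqw]
  rw [← ENNReal.ofReal_tsum_of_nonneg (fun _ => ENNReal.toReal_nonneg) hsum.summable,
    hsum.tsum_eq]

end JumpProb

end QuadrantWalk

/-! ### Asymptotics of the sine transform -/

namespace QuadrantWalk

theorem integral_mul_cexp_neg_mul {r : ℂ} (hr : 0 < r.re) :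
    IntegrableOn (fun u : ℝ => (u : ℂ) * Complex.exp (-r * u)) (Set.Ioi 0) ∧
      ∫ u in Set.Ioi (0 : ℝ), (u : ℂ) * Complex.exp (-r * u) = 1 / r ^ 2 := by
  have hr0 : r ≠ 0 := fun h => by simp [h] at hr
  have hnorm : ∀ u : ℝ, ‖Complex.exp (-r * u)‖ = Real.exp (-(r.re * u)) := fun u => by
    rw [Complex.norm_exp]; simp
  have hint : IntegrableOn (fun u : ℝ => (u : ℂ) * Complex.exp (-r * u)) (Set.Ioi 0) := by
    have h := integrableOn_rpow_mul_exp_neg_mul_rpow (p := 1) (s := 1) (by norm_num) one_pos hr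
    refine Integrable.mono' h (Continuous.aestronglyMeasurable (by fun_prop)) ?_
    refine (ae_restrict_iff' measurableSet_Ioi).2 (Eventually.of_forall fun u hu => ?_)
    rw [norm_mul, hnorm, Complex.norm_real, Real.norm_eq_abs, abs_of_pos hu]
    simp
  refine ⟨hint, ?_⟩
  let g : ℝ → ℂ := fun u => -(u / r + 1 / r ^ 2) * Complex.exp (-r * u)
  have hg : ∀ u ∈ Set.Ici (0 : ℝ), HasDerivAt g ((u : ℂ) * Complex.exp (-r * u)) u := by
    intro u _
    have h0 : HasDerivAt (fun u : ℝ => (u : ℂ)) 1 u := Complex.ofRealCLM.hasDerivAt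
    have h1 := ((h0.div_const r).add_const (1 / r ^ 2)).neg
    have h2 := (h0.const_mul (-r)).cexp
    convert! h1.mul h2 using 1
    simp only [Pi.neg_apply]
    field_simp
    ring
  have hlim : Tendsto g atTop (𝓝 0) := by
    have hx : ∀ k : ℕ, Tendsto (fun u : ℝ => u ^ k * Real.exp (-(r.re * u))) atTop (𝓝 0) := by
      intro k
      have h := (Real.tendsto_pow_mul_exp_neg_atTop_nhds_zero k).comp
        (tendsto_id.const_mul_atTop hr)
      have h' := h.const_mul ((r.re ^ k)⁻¹)
      rw [mul_zero] at h'
      refine h'.congr fun u => ?_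
      simp only [Function.comp, id, mul_pow]
      field_simp
    have hb := ((hx 1).const_mul (1 / ‖r‖)).add ((hx 0).const_mul (1 / ‖r‖ ^ 2))
    simp only [mul_zero, add_zero] at hb
    refine squeeze_zero_norm' ?_ hb
    filter_upwards [eventually_ge_atTop 0] with u hu
    rw [norm_mul, hnorm, norm_neg]
    have h3 : ‖(u : ℂ) / r + 1 / r ^ 2‖ ≤ u / ‖r‖ + 1 / ‖r‖ ^ 2 := by
      refine (norm_add_le _ _).trans (le_of_eq ?_)
      rw [norm_div, norm_div, norm_pow, norm_one, Complex.norm_real, Real.norm_eq_abs,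
        abs_of_nonneg hu]
    calc _ ≤ (u / ‖r‖ + 1 / ‖r‖ ^ 2) * Real.exp (-(r.re * u)) :=
          mul_le_mul_of_nonneg_right h3 (Real.exp_pos _).le
      _ = _ := by ring
  rw [integral_Ioi_of_hasDerivAt_of_tendsto' hg hint hlim]
  simp [g]

theorem integral_mul_sin_mul_exp {c : ℝ} (hc : 0 < c) (s : ℝ) :
    ∫ u in Set.Ioi (0 : ℝ), u * Real.sin (s * u) * Real.exp (-(c * u))
      = 2 * c * s / (c ^ 2 + s ^ 2) ^ 2 := by
  obtain ⟨hint, h⟩ := integral_mul_cexp_neg_mul (r := (c : ℂ) - s * Complex.I) (by simpa using hc)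
  have him' : ∀ u : ℝ, u * Real.sin (s * u) * Real.exp (-(c * u))
      = ((u : ℂ) * Complex.exp (-((c : ℂ) - s * Complex.I) * u)).im := by
    intro u
    have e : -((c : ℂ) - s * Complex.I) * u
        = ((-(c * u) : ℝ) : ℂ) + ((s * u : ℝ) : ℂ) * Complex.I := by push_cast; ring
    rw [e, Complex.exp_add, ← Complex.ofReal_exp, Complex.im_ofReal_mul, Complex.im_ofReal_mul,
      Complex.exp_ofReal_mul_I_im]
    ring
  have hne : (c : ℂ) - s * Complex.I ≠ 0 := fun h0 => by
    have := congrArg Complex.re h0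
    simp at this
    exact hc.ne' this
  simp only [him']
  have him := integral_im (𝕜 := ℂ) hint
  simp only [RCLike.im_to_complex] at him
  rw [him, h]
  have hc2 : (0 : ℝ) < c ^ 2 + s ^ 2 := by positivity
  have hinv : (1 : ℂ) / ((c : ℂ) - s * Complex.I) ^ 2
      = (((c ^ 2 - s ^ 2) / (c ^ 2 + s ^ 2) ^ 2 : ℝ) : ℂ)
        + ((2 * c * s / (c ^ 2 + s ^ 2) ^ 2 : ℝ) : ℂ) * Complex.I := by
    have hc2' : (c : ℂ) ^ 2 + (s : ℂ) ^ 2 ≠ 0 := by exact_mod_cast hc2.ne'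
    rw [div_eq_iff (pow_ne_zero 2 hne)]
    push_cast
    field_simp
    linear_combination ((s : ℂ) ^ 2 * ((s : ℂ) ^ 2 + 3 * c ^ 2) - 2 * c * s ^ 3 * Complex.I)
      * Complex.I_sq
  rw [hinv, Complex.add_im, Complex.ofReal_im, Complex.im_ofReal_mul, Complex.I_im]
  ring

theorem tendsto_nat_mul_div {f : ℝ → ℝ} {f' : ℝ} (hf : HasDerivAt f f' 0) (h0 : f 0 = 0) {u : ℝ}
    (hu : 0 < u) : Tendsto (fun i : ℕ => (i : ℝ) * f (u / i)) atTop (𝓝 (u * f')) := by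
  have h1 := hasDerivAt_iff_tendsto_slope_zero.1 hf
  have h2 : Tendsto (fun i : ℕ => u / (i : ℝ)) atTop (𝓝[≠] 0) := by
    refine tendsto_nhdsWithin_iff.2 ⟨tendsto_const_div_atTop_nhds_zero_nat u, ?_⟩
    filter_upwards [eventually_gt_atTop 0] with i hi
    have : (0 : ℝ) < i := by exact_mod_cast hi
    exact (div_pos hu this).ne'
  refine ((h1.comp h2).const_mul u).congr' ?_
  filter_upwards [eventually_gt_atTop 0] with i hi
  have : (0 : ℝ) < i := by exact_mod_cast hi
  simp [h0]
  field_simp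

theorem hasDerivAt_decayRate_zero (c : ℝ) : HasDerivAt (decayRate c) c 0 := by
  unfold decayRate
  have h1 : HasDerivAt (fun θ : ℝ => c * Real.sin (θ / 2)) (c * (1 / 2)) 0 := by
    have := ((Real.hasDerivAt_sin (0 / 2)).comp 0 ((hasDerivAt_id (0 : ℝ)).div_const 2)).const_mul c
    simpa using this
  have h2 := (h1.arsinh).const_mul 2
  simp at h2
  convert! h2 using 1
  ring

/-- The integrand of `sineGreen`, without the factor carrying the second coordinate of the target,
after the substitution `θ = u / i` and multiplication by `i`. -/
noncomputable def rescaledIntegrand (c : ℝ) (n m i : ℕ) (u : ℝ) : ℝ :=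
  (Set.Ioc 0 (Real.pi * i)).indicator
    (fun u => i * Real.sin (m * (u / i)) * halfLineGreen (decayFactor c (u / i)) n i) u

theorem measurable_rescaledIntegrand (c : ℝ) (n m i : ℕ) :
    Measurable (rescaledIntegrand c n m i) := by
  unfold rescaledIntegrand
  refine Measurable.indicator (Continuous.measurable ?_) measurableSet_Ioc
  have := ((continuous_halfLineGreen n i).comp (continuous_decayFactor c)).comp
    (continuous_id.div_const (i : ℝ))
  exact Continuous.mul (by fun_prop) this

theorem sineGreen_eq_integral_rescaled (a c : ℝ) (n m : ℕ) {i : ℕ} (hi : 0 < i) (j : ℕ) :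
    sineGreen a c n m (i, j) = 2 / (Real.pi * a) / (i : ℝ) ^ 2
      * ∫ u in Set.Ioi (0 : ℝ), Real.sin (j / i * u) * rescaledIntegrand c n m i u := by
  have hi' : (0 : ℝ) < i := by exact_mod_cast hi
  let K : ℝ → ℝ := fun θ =>
    Real.sin (m * θ) * Real.sin (j * θ) * halfLineGreen (decayFactor c θ) n i
  have h1 : ∫ u in Set.Ioi (0 : ℝ), Real.sin (j / i * u) * rescaledIntegrand c n m i u
      = ∫ u in Set.Ioc (0 : ℝ) (Real.pi * i), i * K (u / i) := by
    rw [← integral_indicator measurableSet_Ioi, ← integral_indicator measurableSet_Ioc]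
    congr 1
    ext u
    by_cases hu : u ∈ Set.Ioc (0 : ℝ) (Real.pi * i)
    · rw [Set.indicator_of_mem hu, Set.indicator_of_mem (show u ∈ Set.Ioi (0 : ℝ) from hu.1),
        rescaledIntegrand, Set.indicator_of_mem hu]
      simp only [K]
      rw [show (j : ℝ) / i * u = j * (u / i) by ring]
      ring
    · rw [Set.indicator_of_notMem hu]
      simp [rescaledIntegrand, Set.indicator_of_notMem hu]
  have h2 := intervalIntegral.integral_comp_div (a := 0) (b := Real.pi * i) K hi'.ne'
  rw [zero_div, mul_div_cancel_right₀ _ hi'.ne', intervalIntegral.integral_of_le (by positivity)]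
    at h2
  rw [h1, integral_const_mul, h2, sineGreen]
  change 2 / (Real.pi * a) * (∫ θ in (0 : ℝ)..Real.pi, K θ) = _
  simp only [smul_eq_mul]
  field_simp

/-- An envelope of the rescaled integrands that does not depend on `i`. The exponents occurring in
`halfLineGreen` are at least `i / 2` once `2 n ≤ i`. -/
theorem abs_rescaledIntegrand_le {c : ℝ} (hc : 0 < c) (n m : ℕ) {i : ℕ} (hi : 0 < i)
    (hni : 2 * n ≤ i) {u : ℝ} (hu : 0 < u) :
    |rescaledIntegrand c n m i u|
      ≤ n * m * (u * Real.exp (-(c / (Real.pi * (1 + c)) * u))) := by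
  have hπ := Real.pi_pos
  have hi' : (0 : ℝ) < i := by exact_mod_cast hi
  have hpos : 0 ≤ n * m * (u * Real.exp (-(c / (Real.pi * (1 + c)) * u))) := by positivity
  by_cases h : u ∈ Set.Ioc (0 : ℝ) (Real.pi * i)
  swap
  · rw [rescaledIntegrand, Set.indicator_of_notMem h, abs_zero]
    exact hpos
  rw [rescaledIntegrand, Set.indicator_of_mem h, abs_mul, abs_mul, abs_of_pos hi']
  set θ := u / i with hθ
  have hθ0 : 0 < θ := by positivity
  have hθπ : θ ≤ Real.pi := by rw [hθ, div_le_iff₀ hi']; exact h.2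
  have h1 : |Real.sin (m * θ)| ≤ m * θ := by
    have := Real.abs_sin_le_abs (x := m * θ)
    rwa [abs_of_nonneg (by positivity : 0 ≤ m * θ)] at this
  have hd0 := (decayFactor_pos c θ).le
  have h2 : halfLineGreen (decayFactor c θ) n i
      ≤ n * Real.exp (-(c / (Real.pi * (1 + c)) * u)) := by
    rw [halfLineGreen, min_eq_left (by omega), max_eq_right (by omega)]
    calc _ ≤ ∑ _k ∈ Finset.range n, Real.exp (-(c / (Real.pi * (1 + c)) * u)) := by
          refine Finset.sum_le_sum fun k _ => ?_
          refine (pow_le_pow_left₀ hd0 (decayFactor_le_exp hc hθ0.le hθπ) _).trans ?_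
          rw [← Real.exp_nat_mul, Real.exp_le_exp]
          have hge : (i : ℝ) / 2 ≤ (i - n + 1 + 2 * k : ℕ) := by
            rw [div_le_iff₀ two_pos]
            exact_mod_cast (by omega : i ≤ (i - n + 1 + 2 * k) * 2)
          have hr : 0 ≤ 2 * c / (Real.pi * (1 + c)) * θ := by positivity
          have := mul_le_mul_of_nonneg_right hge hr
          have e : (i : ℝ) / 2 * (2 * c / (Real.pi * (1 + c)) * θ)
              = c / (Real.pi * (1 + c)) * u := by
            rw [hθ]; field_simp
          rw [e] at this
          linarith
      _ = _ := by simp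
  rw [abs_of_nonneg (halfLineGreen_nonneg hd0 n i)]
  calc (i : ℝ) * |Real.sin (m * θ)| * halfLineGreen (decayFactor c θ) n i
      ≤ (i : ℝ) * (m * θ) * (n * Real.exp (-(c / (Real.pi * (1 + c)) * u))) := by
        gcongr
        exact halfLineGreen_nonneg hd0 n i
    _ = _ := by
        rw [hθ]; field_simp

theorem tendsto_rescaledIntegrand (c : ℝ) (n m : ℕ) {u : ℝ} (hu : 0 < u) :
    Tendsto (fun i => rescaledIntegrand c n m i u) atTop
      (𝓝 (n * m * (u * Real.exp (-(c * u))))) := by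
  have hsin : Tendsto (fun i : ℕ => (i : ℝ) * Real.sin (m * (u / i))) atTop (𝓝 (u * m)) := by
    refine tendsto_nat_mul_div (f := fun θ => Real.sin (m * θ)) ?_ (by simp) hu
    have := (Real.hasDerivAt_sin ((m : ℝ) * 0)).comp 0 ((hasDerivAt_id (0 : ℝ)).const_mul (m : ℝ))
    simpa [Function.comp_def] using this
  have hrate : Tendsto (fun i : ℕ => (i : ℝ) * decayRate c (u / i)) atTop (𝓝 (u * c)) :=
    tendsto_nat_mul_div (hasDerivAt_decayRate_zero c) (by simp [decayRate]) hu
  have hpow : ∀ k : ℕ, Tendsto (fun i : ℕ => decayFactor c (u / i) ^ (i - n + 1 + 2 * k)) atTop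
      (𝓝 (Real.exp (-(c * u)))) := by
    intro k
    have hrat : Tendsto (fun i : ℕ => ((i - n + 1 + 2 * k : ℕ) : ℝ) / i) atTop (𝓝 1) := by
      have h0 : Tendsto (fun i : ℕ => 1 + (1 + 2 * k - n : ℝ) / i) atTop (𝓝 (1 + 0)) :=
        (tendsto_const_div_atTop_nhds_zero_nat _).const_add 1
      rw [add_zero] at h0
      refine h0.congr' ?_
      filter_upwards [eventually_gt_atTop n] with i hi
      have : (0 : ℝ) < i := by exact_mod_cast (Nat.zero_le n).trans_lt hi
      push_cast [Nat.cast_sub hi.le]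
      field_simp
      ring
    have h1 := (hrate.mul hrat).neg
    have h2 := (Real.continuous_exp.tendsto _).comp h1
    rw [mul_one, mul_comm u c] at h2
    refine h2.congr' ?_
    filter_upwards [eventually_gt_atTop 0] with i hi
    have : (0 : ℝ) < i := by exact_mod_cast hi
    simp only [Function.comp, decayFactor]
    rw [← Real.exp_nat_mul]
    congr 1
    field_simp
  have hsum : Tendsto (fun i : ℕ => halfLineGreen (decayFactor c (u / i)) n i) atTop
      (𝓝 (n * Real.exp (-(c * u)))) := by
    have h := tendsto_finsetSum (Finset.range n) fun k _ => hpow k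
    simp only [Finset.sum_const, Finset.card_range, nsmul_eq_mul] at h
    refine h.congr' ?_
    filter_upwards [eventually_ge_atTop n] with i hi
    rw [halfLineGreen, min_eq_left hi, max_eq_right hi]
  have hmain := hsin.mul hsum
  have e : u * (m : ℝ) * (n * Real.exp (-(c * u))) = n * m * (u * Real.exp (-(c * u))) := by ring
  rw [e] at hmain
  refine hmain.congr' ?_
  have hlarge : ∀ᶠ i : ℕ in atTop, u / Real.pi ≤ i :=
    tendsto_natCast_atTop_atTop.eventually_ge_atTop _
  filter_upwards [hlarge] with i hi
  rw [div_le_iff₀' Real.pi_pos] at hi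
  rw [rescaledIntegrand,
    Set.indicator_of_mem (show u ∈ Set.Ioc 0 (Real.pi * (i : ℝ)) from ⟨hu, hi⟩)]

theorem integrableOn_sq_mul_exp {r : ℝ} (hr : 0 < r) :
    IntegrableOn (fun u : ℝ => u * (u * Real.exp (-(r * u)))) (Set.Ioi 0) := by
  have h := integrableOn_rpow_mul_exp_neg_mul_rpow (p := 1) (s := 2) (by norm_num) one_pos hr
  refine h.congr_fun (fun u _ => ?_) measurableSet_Ioi
  simp only [Real.rpow_one, Real.rpow_two]
  rw [neg_mul]
  ring

/-- The weighted `L¹` distance between the rescaled integrand and its pointwise limit. -/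
noncomputable def rescaledError (c : ℝ) (n m i : ℕ) : ℝ :=
  ∫ u in Set.Ioi (0 : ℝ), u * |rescaledIntegrand c n m i u - n * m * (u * Real.exp (-(c * u)))|

theorem integrableOn_rescaledError_bound {c : ℝ} (hc : 0 < c) (n m : ℕ) :
    IntegrableOn (fun u : ℝ => n * m * (u * (u * Real.exp (-(c / (Real.pi * (1 + c)) * u))))
      + n * m * (u * (u * Real.exp (-(c * u))))) (Set.Ioi 0) := by
  have hπ := Real.pi_pos
  exact ((integrableOn_sq_mul_exp (by positivity)).const_mul _).add
    ((integrableOn_sq_mul_exp hc).const_mul _)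

theorem rescaledError_integrand_le {c : ℝ} (hc : 0 < c) (n m : ℕ) {i : ℕ} (hi : 0 < i)
    (hni : 2 * n ≤ i) {u : ℝ} (hu : 0 < u) :
    u * |rescaledIntegrand c n m i u - n * m * (u * Real.exp (-(c * u)))|
      ≤ n * m * (u * (u * Real.exp (-(c / (Real.pi * (1 + c)) * u))))
        + n * m * (u * (u * Real.exp (-(c * u)))) := by
  have h1 := abs_rescaledIntegrand_le hc n m hi hni hu
  have h2 := abs_sub (rescaledIntegrand c n m i u) (n * m * (u * Real.exp (-(c * u))))
  rw [abs_of_nonneg (by positivity : 0 ≤ n * m * (u * Real.exp (-(c * u))))] at h2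
  have := mul_le_mul_of_nonneg_left (h2.trans (add_le_add_left h1 _)) hu.le
  linarith

theorem tendsto_rescaledError {c : ℝ} (hc : 0 < c) (n m : ℕ) :
    Tendsto (rescaledError c n m) atTop (𝓝 0) := by
  have h := tendsto_integral_filter_of_dominated_convergence (μ := volume.restrict (Set.Ioi 0))
    (l := atTop) (F := fun i u =>
      u * |rescaledIntegrand c n m i u - n * m * (u * Real.exp (-(c * u)))|) (f := fun _ => (0 : ℝ))
    _ (Eventually.of_forall fun i => by
      have := measurable_rescaledIntegrand c n m i
      refine Measurable.aestronglyMeasurable ?_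
      fun_prop) ?_ (integrableOn_rescaledError_bound hc n m) ?_
  · rw [integral_zero] at h
    exact h
  · filter_upwards [eventually_gt_atTop 0, eventually_ge_atTop (2 * n)] with i hi hni
    refine (ae_restrict_iff' measurableSet_Ioi).2 (Eventually.of_forall fun u hu => ?_)
    have hu : 0 < u := hu
    rw [Real.norm_eq_abs, abs_of_nonneg (by positivity)]
    exact rescaledError_integrand_le hc n m hi hni hu
  · refine (ae_restrict_iff' measurableSet_Ioi).2 (Eventually.of_forall fun u hu => ?_)
    have h1 := ((tendsto_rescaledIntegrand c n m hu).sub_const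
      (n * m * (u * Real.exp (-(c * u))))).abs.const_mul u
    simpa using h1

/-- The leading term of the Green function of the killed walk. -/
noncomputable def leadingTerm (a b : ℝ) (n m : ℕ) (w : ℕ × ℕ) : ℝ :=
  4 * √(b * a) / Real.pi * ((n : ℝ) * (m : ℝ)) *
    ((w.1 : ℝ) * (w.2 : ℝ) / (b * (w.1 : ℝ) ^ 2 + a * (w.2 : ℝ) ^ 2) ^ 2)

/-- The leading term is the rescaled integral with the integrand replaced by its limit; compare
`sineGreen_eq_integral_rescaled`. -/
theorem leadingTerm_eq {a b c : ℝ} (ha : 0 < a) (hc : 0 < c) (hcb : a * c ^ 2 = b) (n m : ℕ)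
    {i : ℕ} (hi : 0 < i) (j : ℕ) :
    leadingTerm a b n m (i, j) = 2 / (Real.pi * a) / (i : ℝ) ^ 2
      * ∫ u in Set.Ioi (0 : ℝ), Real.sin (j / i * u) * (n * m * (u * Real.exp (-(c * u)))) := by
  have hπ := Real.pi_pos
  have hi' : (0 : ℝ) < i := by exact_mod_cast hi
  have e : ∀ u : ℝ, Real.sin (j / i * u) * (n * m * (u * Real.exp (-(c * u))))
      = n * m * (u * Real.sin (j / i * u) * Real.exp (-(c * u))) := fun u => by ring
  simp only [e]
  rw [integral_const_mul, integral_mul_sin_mul_exp hc, leadingTerm]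
  have hsq : √(b * a) = a * c := by
    rw [← hcb, show a * c ^ 2 * a = (a * c) ^ 2 by ring, Real.sqrt_sq (by positivity)]
  rw [hsq, ← hcb]
  have h1 : c ^ 2 * (i : ℝ) ^ 2 + (j : ℝ) ^ 2 ≠ 0 := by positivity
  have h2 : a * c ^ 2 * (i : ℝ) ^ 2 + a * (j : ℝ) ^ 2
      = a * (c ^ 2 * (i : ℝ) ^ 2 + (j : ℝ) ^ 2) := by
    ring
  have h3 : c ^ 2 + ((j : ℝ) / i) ^ 2 = (c ^ 2 * (i : ℝ) ^ 2 + (j : ℝ) ^ 2) / (i : ℝ) ^ 2 := by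
    field_simp
  simp only
  rw [h2, h3]
  field_simp
  ring

/-- The second coordinate `j` of the target enters the error only through a factor `j`, because
`|sin (j u / i)| ≤ (j / i) u`. -/
theorem abs_sineGreen_sub_leadingTerm_le {a b c : ℝ} (ha : 0 < a) (hc : 0 < c)
    (hcb : a * c ^ 2 = b) (n m : ℕ) {i : ℕ} (hi : 0 < i) (hni : 2 * n ≤ i) (j : ℕ) :
    |sineGreen a c n m (i, j) - leadingTerm a b n m (i, j)|
      ≤ 2 / (Real.pi * a) / (i : ℝ) ^ 2 * (j / i * rescaledError c n m i) := by
  have hπ := Real.pi_pos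
  have hi' : (0 : ℝ) < i := by exact_mod_cast hi
  have hcont : Continuous fun u : ℝ => (n : ℝ) * m * (u * Real.exp (-(c * u))) := by fun_prop
  have hdom : ∀ r : ℝ, 0 < r → IntegrableOn
      (fun u : ℝ => j / i * (n * m * (u * (u * Real.exp (-(r * u)))))) (Set.Ioi 0) := fun r hr =>
    ((integrableOn_sq_mul_exp hr).const_mul _).const_mul _
  have hsin : ∀ u : ℝ, 0 < u → |Real.sin (j / i * u)| ≤ j / i * u := fun u hu => by
    have := Real.abs_sin_le_abs (x := j / i * u)
    rwa [abs_of_nonneg (by positivity : 0 ≤ (j : ℝ) / i * u)] at this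
  have hI1 : IntegrableOn (fun u => Real.sin (j / i * u) * rescaledIntegrand c n m i u)
      (Set.Ioi 0) := by
    refine Integrable.mono' (hdom (c / (Real.pi * (1 + c))) (by positivity)) ?_ ?_
    · have := measurable_rescaledIntegrand c n m i
      refine Measurable.aestronglyMeasurable ?_
      fun_prop
    · refine (ae_restrict_iff' measurableSet_Ioi).2 (Eventually.of_forall fun u hu => ?_)
      have hu : 0 < u := hu
      rw [norm_mul, Real.norm_eq_abs, Real.norm_eq_abs]
      calc _ ≤ (j / i * u) * (n * m * (u * Real.exp (-(c / (Real.pi * (1 + c)) * u)))) :=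
            mul_le_mul (hsin u hu) (abs_rescaledIntegrand_le hc n m hi hni hu) (abs_nonneg _)
              (by positivity)
        _ = _ := by ring
  have hI2 : IntegrableOn (fun u => Real.sin (j / i * u) * (n * m * (u * Real.exp (-(c * u)))))
      (Set.Ioi 0) := by
    refine Integrable.mono' (hdom c hc) (Continuous.aestronglyMeasurable (by fun_prop)) ?_
    refine (ae_restrict_iff' measurableSet_Ioi).2 (Eventually.of_forall fun u hu => ?_)
    have hu : 0 < u := hu
    rw [norm_mul, Real.norm_eq_abs, Real.norm_eq_abs,
      abs_of_nonneg (by positivity : 0 ≤ n * m * (u * Real.exp (-(c * u))))]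
    calc _ ≤ (j / i * u) * (n * m * (u * Real.exp (-(c * u)))) :=
          mul_le_mul_of_nonneg_right (hsin u hu) (by positivity)
      _ = _ := by ring
  have hI3 : IntegrableOn (fun u : ℝ =>
      u * |rescaledIntegrand c n m i u - n * m * (u * Real.exp (-(c * u)))|) (Set.Ioi 0) := by
    refine Integrable.mono' (integrableOn_rescaledError_bound hc n m) ?_ ?_
    · have := measurable_rescaledIntegrand c n m i
      refine Measurable.aestronglyMeasurable ?_
      fun_prop
    · refine (ae_restrict_iff' measurableSet_Ioi).2 (Eventually.of_forall fun u hu => ?_)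
      have hu : 0 < u := hu
      rw [Real.norm_eq_abs, abs_of_nonneg (by positivity)]
      exact rescaledError_integrand_le hc n m hi hni hu
  rw [sineGreen_eq_integral_rescaled a c n m hi, leadingTerm_eq ha hc hcb n m hi, ← mul_sub,
    ← integral_sub hI1 hI2, abs_mul, abs_of_pos (by positivity)]
  gcongr
  rw [rescaledError, ← integral_const_mul, ← Real.norm_eq_abs]
  refine norm_integral_le_of_norm_le (hI3.const_mul _) ?_
  refine (ae_restrict_iff' measurableSet_Ioi).2 (Eventually.of_forall fun u hu => ?_)
  have hu : 0 < u := hu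
  rw [← mul_sub, norm_mul, Real.norm_eq_abs, Real.norm_eq_abs, ← mul_assoc ((j : ℝ) / i)]
  exact mul_le_mul_of_nonneg_right (hsin u hu) (abs_nonneg _)

/-- The asymptotics of `sineGreen`, uniformly over the targets in the lower half of the quadrant. -/
theorem eventually_abs_sineGreen_sub_leadingTerm_le {a b c : ℝ} (ha : 0 < a) (hc : 0 < c)
    (hcb : a * c ^ 2 = b) {n m : ℕ} (hn : 0 < n) (hm : 0 < m) {ε : ℝ} (hε : 0 < ε) :
    ∀ᶠ i : ℕ in atTop, ∀ j ≤ i, |sineGreen a c n m (i, j) - leadingTerm a b n m (i, j)|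
      ≤ ε * leadingTerm a b n m (i, j) := by
  have hπ := Real.pi_pos
  have hn' : (0 : ℝ) < n := by exact_mod_cast hn
  have hm' : (0 : ℝ) < m := by exact_mod_cast hm
  -- For `j ≤ i` the integral in `leadingTerm_eq` is at least `j / i` times the bracketed constant.
  have hδ : 0 < ε * (2 * n * m * c / (c ^ 2 + 1) ^ 2) := by positivity
  filter_upwards [(tendsto_rescaledError hc n m).eventually_le_const hδ, eventually_gt_atTop 0,
    eventually_ge_atTop (2 * n)] with i hi hi0 hni j hj
  have hi' : (0 : ℝ) < i := by exact_mod_cast hi0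
  have hji : (j : ℝ) / i ≤ 1 := by
    rw [div_le_one hi']; exact_mod_cast hj
  refine (abs_sineGreen_sub_leadingTerm_le ha hc hcb n m hi0 hni j).trans ?_
  have e : ∀ u : ℝ, Real.sin (j / i * u) * (n * m * (u * Real.exp (-(c * u))))
      = n * m * (u * Real.sin (j / i * u) * Real.exp (-(c * u))) := fun u => by ring
  rw [leadingTerm_eq ha hc hcb n m hi0]
  simp only [e]
  rw [integral_const_mul, integral_mul_sin_mul_exp hc]
  set s : ℝ := (j : ℝ) / i
  have hs0 : 0 ≤ s := by positivity
  have h1 : (c ^ 2 + s ^ 2) ^ 2 ≤ (c ^ 2 + 1) ^ 2 := by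
    gcongr
    nlinarith
  have h2 : rescaledError c n m i ≤ ε * (2 * n * m * c / (c ^ 2 + s ^ 2) ^ 2) :=
    hi.trans (by gcongr)
  calc 2 / (Real.pi * a) / (i : ℝ) ^ 2 * (s * rescaledError c n m i)
      ≤ 2 / (Real.pi * a) / (i : ℝ) ^ 2 * (s * (ε * (2 * n * m * c / (c ^ 2 + s ^ 2) ^ 2))) := by
        gcongr
    _ = _ := by ring

end QuadrantWalk

/-! ### Asymptotics of the Green function and the Martin boundary -/

namespace QuadrantWalk

/-- The filter of neighbourhoods of infinity in the interior of the quadrant. -/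
def interiorAtInfinity : Filter (ℕ × ℕ) := cofinite ⊓ 𝓟 {w | 0 < w.1 ∧ 0 < w.2}

theorem leadingTerm_swap (a b : ℝ) (n m : ℕ) (w : ℕ × ℕ) :
    leadingTerm b a m n w.swap = leadingTerm a b n m w := by
  simp only [leadingTerm, Prod.fst_swap, Prod.snd_swap]
  rw [mul_comm a b, mul_comm (m : ℝ), mul_comm (w.2 : ℝ), add_comm (a * _)]

theorem leadingTerm_eq_mul (a b : ℝ) (n m : ℕ) (w : ℕ × ℕ) :
    leadingTerm a b n m w = n * m * leadingTerm a b 1 1 w := by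
  simp only [leadingTerm, Nat.cast_one]
  ring

theorem leadingTerm_pos {a b : ℝ} (ha : 0 < a) (hb : 0 < b) {n m : ℕ} (hn : 0 < n) (hm : 0 < m)
    {w : ℕ × ℕ} (hw : 0 < w.1 ∧ 0 < w.2) : 0 < leadingTerm a b n m w := by
  have hπ := Real.pi_pos
  obtain ⟨h1, h2⟩ := hw
  unfold leadingTerm
  positivity

theorem killedStep_swap (a b : ℝ) (f : ℕ × ℕ → ℝ) (w : ℕ × ℕ) :
    killedStep a b (fun w => f w.swap) w = killedStep b a f w.swap := by
  obtain ⟨_ | i, _ | j⟩ := w <;> simp only [killedStep, Prod.swap]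
  ring

namespace JumpProb

variable (p : JumpProb)

theorem p10_pos : (0 : ℝ) < p.p10 := by exact_mod_cast pos_iff_ne_zero.2 p.p10_ne

theorem p01_pos : (0 : ℝ) < p.p01 := by exact_mod_cast pos_iff_ne_zero.2 p.p01_ne

variable {p}

theorem two_mul_p10_add_two_mul_p01 (hX : p.driftX = 0) (hY : p.driftY = 0) :
    2 * (p.p10 : ℝ) + 2 * p.p01 = 1 := by
  have hX' : (p.p10 : ℝ) - p.pm10 = 0 := hX
  have hY' : (p.p01 : ℝ) - p.p0m1 = 0 := hY
  have h' : (p.p10 : ℝ) + p.pm10 + p.p01 + p.p0m1 = 1 := by exact_mod_cast p.sum_eq_one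
  linarith

theorem green_eq_sineGreen (hX : p.driftX = 0) (hY : p.driftY = 0) {n m : ℕ} (hn : 0 < n)
    (hm : 0 < m) {w : ℕ × ℕ} (hw : 0 < w.1 ∧ 0 < w.2) :
    p.green (n, m) w = ENNReal.ofReal (sineGreen p.p10 (√(p.p01 / p.p10)) n m w) := by
  have ha := p.p10_pos
  have hb := p.p01_pos
  have hc : 0 < √((p.p01 : ℝ) / p.p10) := by positivity
  refine p.green_eq_of_killedStep hX hY ⟨hn, hm⟩ (abs_sineGreen_le ha hc n m)
    (sineGreen_eq_killedStep ha hc (two_mul_p10_add_two_mul_p01 hX hY) ?_ hn hm) hw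
  rw [Real.sq_sqrt (by positivity)]
  field_simp

/-- The same Green function, as a sine transform in the horizontal variable. -/
theorem green_eq_sineGreen_swap (hX : p.driftX = 0) (hY : p.driftY = 0) {n m : ℕ} (hn : 0 < n)
    (hm : 0 < m) {w : ℕ × ℕ} (hw : 0 < w.1 ∧ 0 < w.2) :
    p.green (n, m) w = ENNReal.ofReal (sineGreen p.p01 (√(p.p10 / p.p01)) m n w.swap) := by
  have ha := p.p10_pos
  have hb := p.p01_pos
  have hc : 0 < √((p.p10 : ℝ) / p.p01) := by positivity
  refine p.green_eq_of_killedStep hX hY ⟨hn, hm⟩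
    (F := fun w => sineGreen p.p01 (√(p.p10 / p.p01)) m n w.swap)
    (fun w => abs_sineGreen_le hb hc m n w.swap) (fun w => ?_) hw
  rw [killedStep_swap, sineGreen_eq_killedStep hb hc (b := (p.p10 : ℝ))
    (by rw [add_comm]; exact two_mul_p10_add_two_mul_p01 hX hY) ?_ hm hn]
  · simp only [Prod.ext_iff, Prod.fst_swap, Prod.snd_swap, and_comm]
  · rw [Real.sq_sqrt (by positivity)]
    field_simp

theorem green_ne_top (hX : p.driftX = 0) (hY : p.driftY = 0) {n m : ℕ} (hn : 0 < n)
    (hm : 0 < m) {w : ℕ × ℕ} (hw : 0 < w.1 ∧ 0 < w.2) : p.green (n, m) w ≠ ⊤ := by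
  rw [green_eq_sineGreen hX hY hn hm hw]
  exact ENNReal.ofReal_ne_top

/-- The asymptotics of the Green function, uniformly over all ways of going to infinity in the
interior of the quadrant, including along a fixed row or column. -/
theorem tendsto_green_div_leadingTerm (hX : p.driftX = 0) (hY : p.driftY = 0) {n m : ℕ}
    (hn : 0 < n) (hm : 0 < m) :
    Tendsto (fun w => (p.green (n, m) w).toReal / leadingTerm p.p10 p.p01 n m w)
      interiorAtInfinity (𝓝 1) := by
  have ha := p.p10_pos
  have hb := p.p01_pos
  refine Metric.tendsto_nhds.2 fun ε hε => ?_
  have h1 := eventually_abs_sineGreen_sub_leadingTerm_le ha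
    (c := √((p.p01 : ℝ) / p.p10)) (b := p.p01) (by positivity)
    (by rw [Real.sq_sqrt (by positivity)]; field_simp) hn hm (half_pos hε)
  have h2 := eventually_abs_sineGreen_sub_leadingTerm_le hb
    (c := √((p.p10 : ℝ) / p.p01)) (b := p.p10) (by positivity)
    (by rw [Real.sq_sqrt (by positivity)]; field_simp) hm hn (half_pos hε)
  obtain ⟨N, hN⟩ := eventually_atTop.1 (h1.and h2)
  refine eventually_inf_principal.2 ?_
  have hfar : ∀ᶠ w : ℕ × ℕ in cofinite, w ∉ Set.Iic (N, N) :=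
    (Set.finite_Iic _).eventually_cofinite_notMem
  filter_upwards [hfar] with w hw hint
  have hL := leadingTerm_pos ha hb hn hm hint
  suffices h : |(p.green (n, m) w).toReal - leadingTerm p.p10 p.p01 n m w|
      ≤ ε / 2 * leadingTerm p.p10 p.p01 n m w by
    rw [Real.dist_eq, div_sub_one hL.ne', abs_div, abs_of_pos hL]
    refine ((div_le_iff₀ hL).2 h).trans_lt (half_lt_self hε)
  -- Replacing a negative value by zero only brings it closer to the positive leading term.
  have hmax : ∀ x : ℝ, |(ENNReal.ofReal x).toReal - leadingTerm p.p10 p.p01 n m w|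
      ≤ |x - leadingTerm p.p10 p.p01 n m w| := fun x => by
    have := abs_max_sub_max_le_abs x (leadingTerm p.p10 p.p01 n m w) 0
    rwa [max_eq_left hL.le, ← ENNReal.toReal_ofReal'] at this
  rw [Set.mem_Iic, Prod.le_def, not_and_or, not_le, not_le] at hw
  rcases le_total w.2 w.1 with hle | hle
  · rw [green_eq_sineGreen hX hY hn hm hint]
    exact (hmax _).trans ((hN w.1 (by simp only at hw; omega)).1 w.2 hle)
  · rw [green_eq_sineGreen_swap hX hY hn hm hint]
    have := (hN w.2 (by simp only at hw; omega)).2 w.1 hle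
    rw [show (w.2, w.1) = w.swap from rfl, leadingTerm_swap] at this
    exact (hmax _).trans this

theorem tendsto_green_div_green (hX : p.driftX = 0) (hY : p.driftY = 0) (z : ℕ × ℕ) :
    Tendsto (fun w => p.green z w / p.green (1, 1) w) interiorAtInfinity
      (𝓝 ((z.1 : ℝ≥0∞) * (z.2 : ℝ≥0∞))) := by
  have hint : ∀ᶠ w : ℕ × ℕ in interiorAtInfinity, 0 < w.1 ∧ 0 < w.2 :=
    mem_inf_of_right (mem_principal_self _)
  have ha := p.p10_pos
  have hb := p.p01_pos
  by_cases hz : z.1 = 0 ∨ z.2 = 0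
  · have e : (z.1 : ℝ≥0∞) * (z.2 : ℝ≥0∞) = 0 := by rcases hz with h | h <;> simp [h]
    rw [e]
    refine tendsto_const_nhds.congr' ?_
    filter_upwards [hint] with w hw
    rw [p.green_eq_zero_of_axis hz hw, ENNReal.zero_div]
  obtain ⟨n, m⟩ := z
  have hn : 0 < n := by simp only at hz; omega
  have hm : 0 < m := by simp only at hz; omega
  have h1 := tendsto_green_div_leadingTerm hX hY hn hm
  have h2 := tendsto_green_div_leadingTerm hX hY one_pos one_pos
  have h3 := ENNReal.tendsto_ofReal ((h1.div h2 one_ne_zero).const_mul ((n : ℝ) * m))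
  have e : ENNReal.ofReal ((n : ℝ) * m * (1 / 1)) = (n : ℝ≥0∞) * m := by
    rw [div_one, mul_one, ENNReal.ofReal_mul (by positivity), ENNReal.ofReal_natCast,
      ENNReal.ofReal_natCast]
  rw [e] at h3
  refine h3.congr' ?_
  filter_upwards [hint, h2.eventually (lt_mem_nhds one_pos)] with w hw hpos
  have hL := leadingTerm_pos ha hb one_pos one_pos hw
  have hG : 0 < (p.green (1, 1) w).toReal := by
    by_contra! h
    exact absurd hpos (div_nonpos_of_nonpos_of_nonneg h hL.le).not_gt
  have hn' : (0 : ℝ) < n := by exact_mod_cast hn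
  have hm' : (0 : ℝ) < m := by exact_mod_cast hm
  simp only [Pi.div_apply]
  rw [leadingTerm_eq_mul p.p10 p.p01 n m]
  have e2 : (n : ℝ) * m * ((p.green (n, m) w).toReal / (n * m * leadingTerm p.p10 p.p01 1 1 w)
      / ((p.green (1, 1) w).toReal / leadingTerm p.p10 p.p01 1 1 w))
      = (p.green (n, m) w).toReal / (p.green (1, 1) w).toReal := by
    field_simp
  rw [e2, ENNReal.ofReal_div_of_pos hG, ENNReal.ofReal_toReal (green_ne_top hX hY hn hm hw),
    ENNReal.ofReal_toReal (green_ne_top hX hY one_pos one_pos hw)]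

end JumpProb

/-- The interior point through which an axis point is entered; interior points are fixed. -/
def pushInterior (w : ℕ × ℕ) : ℕ × ℕ := (max w.1 1, max w.2 1)

theorem tendsto_pushInterior :
    Tendsto (fun w : State => pushInterior w.1) cofinite interiorAtInfinity := by
  refine tendsto_inf.2 ⟨?_, tendsto_principal.2 (Eventually.of_forall fun w => ?_)⟩
  · refine le_cofinite_iff_eventually_ne.2 fun v => ?_
    rw [eventually_map, eventually_cofinite]
    refine ((Set.finite_Iic v).preimage Subtype.val_injective.injOn).subset fun w hw => ?_
    rw [Set.mem_ofPred_eq, not_not] at hw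
    rw [Set.mem_preimage, Set.mem_Iic, ← hw]
    exact ⟨le_max_left _ _, le_max_left _ _⟩
  · simp [pushInterior]

namespace JumpProb

variable (p : JumpProb)

/-- Hitting an axis point means jumping to it from its interior neighbour, so that the Martin kernel
at an axis point is a quotient of Green functions at that neighbour. -/
theorem martinKernel_eq_green_div_green {z w : State} (hzw : z ≠ w) :
    p.martinKernel z w = p.green z.1 (pushInterior w.1) / p.green (1, 1) (pushInterior w.1) := by
  obtain ⟨z, hz⟩ := z
  obtain ⟨⟨i, j⟩, hw⟩ := w
  have hne : z ≠ (i, j) := fun h => hzw (Subtype.ext h)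
  unfold martinKernel
  rcases i with _ | i
  · rcases j with _ | j
    · exact absurd rfl hw
    have h0 : (p.pm10 : ℝ≥0∞) ≠ 0 := by exact_mod_cast p.pm10_ne
    rw [if_neg (by simp)]
    simp only [hitProb_vertical_axis, if_neg hne, pushInterior]
    rw [if_neg (by simp), zero_add, zero_add, ENNReal.mul_div_mul_left _ _ h0 ENNReal.coe_ne_top]
    simp
  rcases j with _ | j
  · have h0 : (p.p0m1 : ℝ≥0∞) ≠ 0 := by exact_mod_cast p.p0m1_ne
    rw [if_neg (by simp)]
    simp only [hitProb_horizontal_axis, if_neg hne, pushInterior]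
    rw [if_neg (by simp), zero_add, zero_add, ENNReal.mul_div_mul_left _ _ h0 ENNReal.coe_ne_top]
    simp
  · rw [if_pos (by simp)]
    simp [pushInterior]

variable {p}

theorem tendsto_martinKernel (hX : p.driftX = 0) (hY : p.driftY = 0) (z : State) :
    Tendsto (fun w => p.martinKernel z w) cofinite (𝓝 ((z.1.1 : ℝ≥0∞) * (z.1.2 : ℝ≥0∞))) := by
  refine ((tendsto_green_div_green hX hY z.1).comp tendsto_pushInterior).congr' ?_
  filter_upwards [(Set.finite_singleton z).eventually_cofinite_notMem] with w hw
  exact (p.martinKernel_eq_green_div_green fun h => hw h.symm).symm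

theorem martinBoundary_eq (hX : p.driftX = 0) (hY : p.driftY = 0) :
    p.martinBoundary = {((OnePoint.infty : OnePoint State),
      fun z : State => (z.1.1 : ℝ≥0∞) * (z.1.2 : ℝ≥0∞))} := by
  set ξ : OnePoint State × (State → ℝ≥0∞) :=
    (OnePoint.infty, fun z : State => (z.1.1 : ℝ≥0∞) * (z.1.2 : ℝ≥0∞))
  have hlim : Tendsto p.martinEmbedding cofinite (𝓝 ξ) := by
    refine Tendsto.prodMk_nhds ?_ (tendsto_pi_nhds.2 fun z => tendsto_martinKernel hX hY z)
    rw [← cocompact_eq_cofinite, ← coclosedCompact_eq_cocompact]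
    exact OnePoint.tendsto_coe_infty
  have : Infinite State := Infinite.of_injective (fun n : ℕ => (⟨(n + 1, 0), by simp⟩ : State))
    fun n m h => by simpa using h
  have hnot : ξ ∉ Set.range p.martinEmbedding := by
    rintro ⟨w, hw⟩
    exact OnePoint.coe_ne_infty w (congrArg Prod.fst hw)
  have hcl : p.martinCompactification = insert ξ (Set.range p.martinEmbedding) := by
    refine Set.Subset.antisymm (closure_minimal (Set.subset_insert _ _)
      hlim.isCompact_insert_range_of_cofinite.isClosed) (Set.insert_subset ?_ subset_closure)
    exact mem_closure_of_tendsto hlim (Eventually.of_forall fun w => Set.mem_range_self w)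
  rw [martinBoundary, hcl, Set.insert_sdiff_of_notMem _ hnot, Set.sdiff_self, insert_empty_eq]

end JumpProb

end QuadrantWalk

theorem mainTheorem8 (p : QuadrantWalk.JumpProb) (hX : p.driftX = 0) (hY : p.driftY = 0) :
    (∀ n₀ m₀ : ℕ, 0 < n₀ → 0 < m₀ →
      (∀ i j : ℕ, 0 < i → 0 < j → p.green (n₀, m₀) (i, j) < ⊤) ∧
      ∀ (t : ℝ≥0∞) (i j : ℕ → ℕ), Tendsto i atTop atTop → Tendsto j atTop atTop →
        Tendsto (fun k => (j k : ℝ≥0∞) / (i k : ℝ≥0∞)) atTop (𝓝 t) →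
        (fun k => (p.green (n₀, m₀) (i k, j k)).toReal) ~[atTop]
          fun k => 4 * √((p.p01 : ℝ) * (p.p10 : ℝ)) / Real.pi * ((n₀ : ℝ) * (m₀ : ℝ)) *
            ((i k : ℝ) * (j k : ℝ) /
              ((p.p01 : ℝ) * (i k : ℝ) ^ 2 + (p.p10 : ℝ) * (j k : ℝ) ^ 2) ^ 2)) ∧
    p.martinBoundary =
      {((OnePoint.infty : OnePoint QuadrantWalk.State),
        fun z : QuadrantWalk.State => (z.1.1 : ℝ≥0∞) * (z.1.2 : ℝ≥0∞))} := by
  refine ⟨fun n m hn hm => ⟨fun i j hi hj =>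
    (QuadrantWalk.JumpProb.green_ne_top hX hY hn hm ⟨hi, hj⟩).lt_top, fun t i j hi hj _ => ?_⟩,
    QuadrantWalk.JumpProb.martinBoundary_eq hX hY⟩
  have hpath : Tendsto (fun k => (i k, j k)) atTop QuadrantWalk.interiorAtInfinity := by
    refine tendsto_inf.2 ⟨le_cofinite_iff_eventually_ne.2 fun v => ?_, tendsto_principal.2 ?_⟩
    · rw [eventually_map]
      filter_upwards [hi.eventually_gt_atTop v.1] with k hk h
      rw [← h] at hk
      exact lt_irrefl _ hk
    · filter_upwards [hi.eventually_gt_atTop 0, hj.eventually_gt_atTop 0] with k h1 h2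
      exact ⟨h1, h2⟩
  exact isEquivalent_of_tendsto_one
    ((QuadrantWalk.JumpProb.tendsto_green_div_leadingTerm hX hY hn hm).comp hpath)
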